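/- Let $m\ge 0$, $n\ge 1$ be integers, $a<b$, $\gamma\in\mathbb R$, $\alpha_0,\dots,\alpha_{n-1}\in\mathbb R^m$, and let $L=L(t,x_0,\dots,x_n,z)\in C^1([a,b]\times(\mathbb R^m)^{n+1}\times\mathbb R;\mathbb R)$. Write $PC^k([a,b])$ ($k\ge 1$) for the functions that are $C^{k-1}$ on $[a,b]$ and whose derivative of order $k$ exists outside a finite set and is piecewise continuous (finitely many discontinuities, finite one-sided limits everywhere). Put $\langle x,z\rangle_n(t)=(t,x(t),\dot x(t),\dots,x^{(n)}(t),z(t))$, and write $\partial L/\partial x^{(j)}\in\mathbb R^m$ for the gradient of $L$ in $x_j$. A pair $(x,z)$ with $x\in PC^n([a,b];\mathbb R^m)$, $z\in PC^1([a,b];\mathbb R)$ is admissible if $z(a)=\gamma$ and $\dot z(t)=L\langle x,z\rangle_n(t)$ on $[a,b]$ outside a finite set. An admissible pair $(x,z)$ with $x^{(k)}(a)=\alpha_k$ for $0\le k<n$ is an extremizer if for some $\varepsilon>0$ either $w(b)\ge z(b)$ for all, or $w(b)\le z(b)$ for all, admissible pairs $(y,w)$ with $y^{(k)}(a)=\alpha_k$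 for $0\le k<n$, $\max_{[a,b]}|y-x|<\varepsilon$ and $\max_{[a,b]}|w-z|<\varepsilon$. **Theorem.** Let $(x,z)$ be an extremizer, and put $$\psi_z(t)=\exp\Big(\int_t^b\frac{\partial L}{\partial z}\langle x,z\rangle_n(\theta)\,d\theta\Big),\qquad f_j(t)=\psi_z(t)\,\frac{\partial L}{\partial x^{(j)}}\langle x,z\rangle_n(t)\quad(0\le j\le n).$$ Then the Euler–Lagrange equation $$\sum_{j=0}^n(-1)^j\frac{d^j}{dt^j}\Big(\psi_z\frac{\partial L}{\partial x^{(j)}}\langle x,z\rangle_n\Big)=0$$ holds on $(a,b)$ in the sense of distributions, and for $j=1,\dots,n$ the distribution $$\psi_j=\sum_{i=0}^{n-j}(-1)^{i+1}\frac{d^i}{dt^i}\Big(\psi_z\frac{\partial L}{\partial x^{(i+j)}}\langle x,z\rangle_n\Big)$$ is a function $\psi_j\in PC^1([a,b];\mathbb R^m)$ satisfying the transversality condition $\psi_j(b)=0$. Moreover, let $R\subseteq[a,b]$ be the set of points where $x^{(n)}$ exists (one-sidedly at $a$ and $b$); its complement in $[a,b]$ is finite. At every $t\in R$ these relations hold pointwise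 in grouped form: $\psi_n=-f_n$; for $1\le j<n$, $\psi_{j+1}$ is differentiable at $t$ and $\psi_j=-\dot\psi_{j+1}-f_j$; and $\psi_1$ is differentiable at $t$ with $\dot\psi_1=-f_0$. Finally, on every nondegenerate interval $J\subseteq R$ on which each $f_j$ ($0\le j\le n$) is $j$ times differentiable (one-sidedly at endpoints of $J$ in $J$), the Euler–Lagrange equation and the formulas for $\psi_1,\dots,\psi_n$ hold at every point of $J$ with classical derivatives. -/

import Mathlib

open Set Filter Topology
open scoped ContDiff

noncomputable section

namespace Herglotz

variable {F : Type*} [NormedAddCommGroup F] [NormedSpace ℝ F]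

/-- `u` is piecewise continuous on `[a,b]`: continuous at all but finitely many points of `[a,b]`,
with finite one-sided limits at every point. The values at the exceptional points play no role. -/
structure IsPiecewiseContinuous (a b : ℝ) (u : ℝ → F) : Prop where
  continuous_off_finite :
    ∃ S : Finset ℝ, ∀ t ∈ Icc a b, t ∉ S → ContinuousWithinAt u (Icc a b) t
  left_limit : ∀ t ∈ Ioc a b, ∃ l : F, Tendsto u (𝓝[<] t) (𝓝 l)
  right_limit : ∀ t ∈ Ico a b, ∃ l : F, Tendsto u (𝓝[>] t) (𝓝 l)

/-- `x ∈ PC^n([a,b])`: `x` is `C^(n-1)` on `[a,b]`, its derivative of order `n` exists at all but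
finitely many points of `[a,b]`, and this derivative is piecewise continuous. For `n = 1`: continuous
and piecewise continuously differentiable. Derivatives at `a` and `b` are one-sided. -/
structure IsPC (n : ℕ) (a b : ℝ) (x : ℝ → F) : Prop where
  contDiffOn : ∀ k : ℕ, k < n → ContDiffOn ℝ k x (Icc a b)
  differentiable_off_finite :
    ∃ S : Finset ℝ, ∀ k : ℕ, k < n → ∀ t ∈ Icc a b, t ∉ S →
      DifferentiableWithinAt ℝ (iteratedDerivWithin k x (Icc a b)) (Icc a b) t
  piecewiseContinuous : IsPiecewiseContinuous a b (iteratedDerivWithin n x (Icc a b))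

/-- The arguments `(t, (x₀, …, xₙ), z)` of a Lagrangian of order `n` for curves in `ℝ^m`. -/
abbrev Jet (m n : ℕ) : Type := ℝ × (Fin (n + 1) → EuclideanSpace ℝ (Fin m)) × ℝ

variable {m : ℕ}

/-- `⟨x,z⟩ₙ(t) = (t, x(t), x'(t), …, x^(n)(t), z(t))`. -/
def bracket (n : ℕ) (a b : ℝ) (x : ℝ → EuclideanSpace ℝ (Fin m)) (z : ℝ → ℝ) (t : ℝ) : Jet m n :=
  (t, fun k => iteratedDerivWithin (k : ℕ) x (Icc a b) t, z t)

/-- The partial gradient `∂L/∂x^(j) ∈ ℝ^m` for `j ≤ n` (set to `0` for `j > n`). -/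
def partialX {n : ℕ} (L : Jet m n → ℝ) (j : ℕ) (p : Jet m n) : EuclideanSpace ℝ (Fin m) :=
  if h : j < n + 1 then
    gradient (fun y => L (p.1, Function.update p.2.1 ⟨j, h⟩ y, p.2.2)) (p.2.1 ⟨j, h⟩)
  else 0

/-- The partial derivative `∂L/∂z`. -/
def partialZ {n : ℕ} (L : Jet m n → ℝ) (p : Jet m n) : ℝ :=
  deriv (fun w => L (p.1, p.2.1, w)) p.2.2

/-- Admissible pairs: `x ∈ PC^n`, `z ∈ PC^1`, `z(a) = γ` and `z' = L⟨x,z⟩ₙ` on `[a,b]` outside a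
finite set of points. -/
structure IsAdmissible (n : ℕ) (a b γ : ℝ) (L : Jet m n → ℝ)
    (x : ℝ → EuclideanSpace ℝ (Fin m)) (z : ℝ → ℝ) : Prop where
  pc_x : IsPC n a b x
  pc_z : IsPC 1 a b z
  init_z : z a = γ
  ode : ∃ S : Finset ℝ, ∀ t ∈ Icc a b, t ∉ S →
    HasDerivWithinAt z (L (bracket n a b x z t)) (Icc a b) t

/-- The initial conditions `x^(k)(a) = α_k`, `k = 0, …, n-1`. -/
def HasInitialValues (n : ℕ) (a b : ℝ) (α : Fin n → EuclideanSpace ℝ (Fin m))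
    (x : ℝ → EuclideanSpace ℝ (Fin m)) : Prop :=
  ∀ k : Fin n, iteratedDerivWithin (k : ℕ) x (Icc a b) a = α k

/-- `(x,z)` is an extremizer of the Herglotz problem with the initial conditions `α`:
it is admissible, satisfies the initial conditions, and for some `ε > 0` the difference `w(b) - z(b)`
has a constant sign for all admissible `(y,w)` with the same initial conditions that are `ε`-close
to `(x,z)` in the maximum norm. -/
structure IsExtremizer (n : ℕ) (a b γ : ℝ) (α : Fin n → EuclideanSpace ℝ (Fin m))
    (L : Jet m n → ℝ) (x : ℝ → EuclideanSpace ℝ (Fin m)) (z : ℝ → ℝ) : Prop where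
  admissible : IsAdmissible n a b γ L x z
  init_x : HasInitialValues n a b α x
  extremal : ∃ ε : ℝ, 0 < ε ∧
    ((∀ (y : ℝ → EuclideanSpace ℝ (Fin m)) (w : ℝ → ℝ),
        IsAdmissible n a b γ L y w → HasInitialValues n a b α y →
        (∀ t ∈ Icc a b, ‖w t - z t‖ < ε) → (∀ t ∈ Icc a b, ‖y t - x t‖ < ε) →
        0 ≤ w b - z b) ∨
     (∀ (y : ℝ → EuclideanSpace ℝ (Fin m)) (w : ℝ → ℝ),
        IsAdmissible n a b γ L y w → HasInitialValues n a b α y →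
        (∀ t ∈ Icc a b, ‖w t - z t‖ < ε) → (∀ t ∈ Icc a b, ‖y t - x t‖ < ε) →
        w b - z b ≤ 0))

/-- `ψ_z(t) = exp (∫_t^b ∂L/∂z ⟨x,z⟩ₙ(θ) dθ)`. -/
def psiZ (n : ℕ) (a b : ℝ) (L : Jet m n → ℝ)
    (x : ℝ → EuclideanSpace ℝ (Fin m)) (z : ℝ → ℝ) (t : ℝ) : ℝ :=
  Real.exp (∫ θ in t..b, partialZ L (bracket n a b x z θ))

/-- `ψ_z(t) ∂L/∂x^(j) ⟨x,z⟩ₙ(t)`. -/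
def momentum (n : ℕ) (a b : ℝ) (L : Jet m n → ℝ)
    (x : ℝ → EuclideanSpace ℝ (Fin m)) (z : ℝ → ℝ) (j : ℕ) (t : ℝ) : EuclideanSpace ℝ (Fin m) :=
  psiZ n a b L x z t • partialX L j (bracket n a b x z t)

/-- The points of `[a,b]` at which the derivative of order `n` of `x` exists (`n ≥ 1`). -/
def regularPoints (n : ℕ) (a b : ℝ) (x : ℝ → EuclideanSpace ℝ (Fin m)) : Set ℝ :=
  {t | t ∈ Icc a b ∧
    DifferentiableWithinAt ℝ (iteratedDerivWithin (n - 1) x (Icc a b)) (Icc a b) t}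

/-- Smooth test functions with compact support in `(a,b)`. -/
structure IsTestFunction (a b : ℝ) (η : ℝ → ℝ) : Prop where
  smooth : ContDiff ℝ ∞ η
  compact : HasCompactSupport η
  support : tsupport η ⊆ Ioo a b

/-- The value at the test function `η` of the `i`-th distributional derivative of `g` on `(a,b)`. -/
def distDeriv (a b : ℝ) (i : ℕ) (g : ℝ → F) (η : ℝ → ℝ) : F :=
  (-1 : ℝ) ^ i • ∫ t in a..b, iteratedDeriv i η t • g t

/-- `g` is `j` times differentiable on the interval `J` (one-sidedly at endpoints in `J`). -/
def IsTimesDifferentiableOn (j : ℕ) (g : ℝ → F) (J : Set ℝ) : Prop :=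
  ∀ k : ℕ, k < j → DifferentiableOn ℝ (iteratedDerivWithin k g J) J

end Herglotz

end

/-!
An extremizer `(x,z)` is compared with the pairs obtained from the curves `x + s • G`, where `G` is
smooth and `G, …, G^(n-1)` vanish at `a`. With `w = z + u`, the equation `w' = L` becomes a Volterra
equation for `u`. After `u` is clamped to `[-1,1]` its right-hand side is Lipschitz in `u`, and the
contraction principle in an exponentially weighted maximum norm gives a solution on all of `[a,b]`
with `u = O(s)`, so that the clamp is inactive for small `s` (`exists_integral_equation_solution`,
`exists_shift_solution`).

The function `ψ_z` is an integrating factor for the linearised equation, and dominated convergence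
gives `u(b)/s → ∫ ψ_z · L'(⟨x,z⟩)(0, G, …, G^(n), 0)` (`tendsto_shift_solution`). Since `u(b)` has a
constant sign for small `s` of both signs, this integral vanishes. For `G = h • v` it is the scalar
product of `v` with `∫ ∑ h^(j) f_j` (`IsExtremizer.sum_integral_momentum_eq_zero`).

The multipliers are defined by `ψ₀ = 0` and `ψ_{j+1}(t) = ∫_t^b (ψ_j + f_j)`, so that `ψ_j(b) = 0` and
`ψ_{j+1}' = -ψ_j - f_j`. Integration by parts turns the vanishing first variation into
`∫ h^(n) • (ψ_n + f_n) = 0`, and `h^(n)` is an arbitrary smooth function because nothing is prescribed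
at `b`. Hence `ψ_n = -f_n` wherever `f_n` is continuous. This holds at all points where `x^(n)` exists:
the one-sided limits of a derivative are one-sided derivatives, so `x^(n)` is continuous there
(`IsPC.continuousWithinAt_of_differentiableWithinAt`). The formulas for the `ψ_j`, in the distributional
and in the classical sense, follow by descending induction on `j` from `ψ_n = -f_n` and
`ψ_j = -ψ_{j+1}' - f_j`; the case `j = 0`, where `ψ₀ = 0`, is the Euler-Lagrange equation.
-/

namespace Herglotz

open MeasureTheory

section PiecewiseContinuity

variable {F G : Type*} [NormedAddCommGroup F] [NormedAddCommGroup G] {a b : ℝ}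

/-! ### Piecewise continuous functions -/

lemma eventually_notMem_nhdsNE (S : Finset ℝ) (t : ℝ) : ∀ᶠ s in 𝓝[≠] t, s ∉ S :=
  nhdsNE_le_cofinite t S.finite_toSet.compl_mem_cofinite

lemma eventually_notMem_nhds (S : Finset ℝ) {t : ℝ} (ht : t ∉ S) : ∀ᶠ s in 𝓝 t, s ∉ S :=
  S.finite_toSet.isClosed.isOpen_compl.mem_nhds ht

lemma nhdsLT_le_nhdsWithin_Icc {t : ℝ} (ht : t ∈ Ioc a b) : 𝓝[<] t ≤ 𝓝[Icc a b] t :=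
  le_inf inf_le_left (le_principal_iff.2
    (mem_of_superset (Icc_mem_nhdsLT_of_mem ht) subset_rfl))

lemma nhdsGT_le_nhdsWithin_Icc {t : ℝ} (ht : t ∈ Ico a b) : 𝓝[>] t ≤ 𝓝[Icc a b] t :=
  le_inf inf_le_left (le_principal_iff.2
    (mem_of_superset (Icc_mem_nhdsGT_of_mem ht) subset_rfl))

/-- Piecewise continuity does not see changes at finitely many points. -/
lemma IsPiecewiseContinuous.congr_off_finite {u v : ℝ → F} (hu : IsPiecewiseContinuous a b u)
    (S : Finset ℝ) (h : ∀ t ∈ Icc a b, t ∉ S → u t = v t) : IsPiecewiseContinuous a b v := by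
  classical
  refine ⟨?_, fun t ht => ?_, fun t ht => ?_⟩
  · obtain ⟨S', hS'⟩ := hu.continuous_off_finite
    refine ⟨S ∪ S', fun t ht htS => ?_⟩
    rw [Finset.notMem_union] at htS
    refine (hS' t ht htS.2).congr_of_eventuallyEq ?_ (h t ht htS.1).symm
    filter_upwards [self_mem_nhdsWithin, nhdsWithin_le_nhds (eventually_notMem_nhds S htS.1)]
      with s hs hsS using (h s hs hsS).symm
  · obtain ⟨l, hl⟩ := hu.left_limit t ht
    refine ⟨l, hl.congr' ?_⟩
    filter_upwards [Icc_mem_nhdsLT_of_mem ht,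
      nhdsLT_le_nhdsNE t (eventually_notMem_nhdsNE S t)] with s hs hsS using h s hs hsS
  · obtain ⟨l, hl⟩ := hu.right_limit t ht
    refine ⟨l, hl.congr' ?_⟩
    filter_upwards [Icc_mem_nhdsGT_of_mem ht,
      nhdsGT_le_nhdsNE t (eventually_notMem_nhdsNE S t)] with s hs hsS using h s hs hsS

lemma isPiecewiseContinuous_of_continuousOn {u : ℝ → F} (hu : ContinuousOn u (Icc a b)) :
    IsPiecewiseContinuous a b u :=
  ⟨⟨∅, fun t ht _ => hu t ht⟩,
    fun t ht => ⟨u t, (hu t ⟨ht.1.le, ht.2⟩).mono_left (nhdsLT_le_nhdsWithin_Icc ht)⟩,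
    fun t ht => ⟨u t, (hu t ⟨ht.1, ht.2.le⟩).mono_left (nhdsGT_le_nhdsWithin_Icc ht)⟩⟩

lemma IsPiecewiseContinuous.prodMk {u : ℝ → F} {v : ℝ → G} (hu : IsPiecewiseContinuous a b u)
    (hv : IsPiecewiseContinuous a b v) : IsPiecewiseContinuous a b (fun t => (u t, v t)) := by
  classical
  refine ⟨?_, fun t ht => ?_, fun t ht => ?_⟩
  · obtain ⟨S, hS⟩ := hu.continuous_off_finite
    obtain ⟨T, hT⟩ := hv.continuous_off_finite
    refine ⟨S ∪ T, fun t ht htS => ?_⟩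
    rw [Finset.notMem_union] at htS
    exact (hS t ht htS.1).prodMk (hT t ht htS.2)
  · obtain ⟨l, hl⟩ := hu.left_limit t ht
    obtain ⟨k, hk⟩ := hv.left_limit t ht
    exact ⟨(l, k), hl.prodMk_nhds hk⟩
  · obtain ⟨l, hl⟩ := hu.right_limit t ht
    obtain ⟨k, hk⟩ := hv.right_limit t ht
    exact ⟨(l, k), hl.prodMk_nhds hk⟩

lemma isPiecewiseContinuous_pi {ι : Type*} [Fintype ι] {u : ℝ → ι → F}
    (hu : ∀ i, IsPiecewiseContinuous a b (fun t => u t i)) : IsPiecewiseContinuous a b u := by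
  classical
  refine ⟨?_, fun t ht => ?_, fun t ht => ?_⟩
  · choose S hS using fun i => (hu i).continuous_off_finite
    refine ⟨Finset.univ.biUnion S, fun t ht htS => continuousWithinAt_pi.2 fun i => hS i t ht ?_⟩
    exact fun h => htS (Finset.mem_biUnion.2 ⟨i, Finset.mem_univ i, h⟩)
  · choose l hl using fun i => (hu i).left_limit t ht
    exact ⟨l, tendsto_pi_nhds.2 hl⟩
  · choose l hl using fun i => (hu i).right_limit t ht
    exact ⟨l, tendsto_pi_nhds.2 hl⟩

/-- The set `K` is closed so that it also contains the one-sided limits of `u`. -/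
lemma IsPiecewiseContinuous.comp_continuousOn {u : ℝ → F} (hu : IsPiecewiseContinuous a b u)
    {K : Set F} (hK : IsClosed K) (hmem : ∀ t ∈ Icc a b, u t ∈ K) {Φ : F → G}
    (hΦ : ContinuousOn Φ K) : IsPiecewiseContinuous a b (fun t => Φ (u t)) := by
  refine ⟨?_, fun t ht => ?_, fun t ht => ?_⟩
  · obtain ⟨S, hS⟩ := hu.continuous_off_finite
    exact ⟨S, fun t ht htS => (hΦ _ (hmem t ht)).comp (hS t ht htS) hmem⟩
  · obtain ⟨l, hl⟩ := hu.left_limit t ht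
    have hev : ∀ᶠ s in 𝓝[<] t, u s ∈ K := by
      filter_upwards [Icc_mem_nhdsLT_of_mem ht] with s hs using hmem s hs
    exact ⟨Φ l, (hΦ l (hK.mem_of_tendsto hl hev)).tendsto.comp
      (tendsto_nhdsWithin_iff.2 ⟨hl, hev⟩)⟩
  · obtain ⟨l, hl⟩ := hu.right_limit t ht
    have hev : ∀ᶠ s in 𝓝[>] t, u s ∈ K := by
      filter_upwards [Icc_mem_nhdsGT_of_mem ht] with s hs using hmem s hs
    exact ⟨Φ l, (hΦ l (hK.mem_of_tendsto hl hev)).tendsto.comp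
      (tendsto_nhdsWithin_iff.2 ⟨hl, hev⟩)⟩

lemma IsPiecewiseContinuous.comp_continuous {u : ℝ → F} (hu : IsPiecewiseContinuous a b u)
    {Φ : F → G} (hΦ : Continuous Φ) : IsPiecewiseContinuous a b (fun t => Φ (u t)) :=
  hu.comp_continuousOn isClosed_univ (fun _ _ => mem_univ _) hΦ.continuousOn

lemma IsPiecewiseContinuous.add {u v : ℝ → F} (hu : IsPiecewiseContinuous a b u)
    (hv : IsPiecewiseContinuous a b v) : IsPiecewiseContinuous a b (fun t => u t + v t) :=
  (hu.prodMk hv).comp_continuous (Φ := fun p : F × F => p.1 + p.2) (by fun_prop)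

lemma IsPiecewiseContinuous.sub {u v : ℝ → F} (hu : IsPiecewiseContinuous a b u)
    (hv : IsPiecewiseContinuous a b v) : IsPiecewiseContinuous a b (fun t => u t - v t) :=
  (hu.prodMk hv).comp_continuous (Φ := fun p : F × F => p.1 - p.2) (by fun_prop)

lemma IsPiecewiseContinuous.neg {u : ℝ → F} (hu : IsPiecewiseContinuous a b u) :
    IsPiecewiseContinuous a b (fun t => -u t) :=
  hu.comp_continuous continuous_neg

lemma IsPiecewiseContinuous.exists_bound {u : ℝ → F} (hu : IsPiecewiseContinuous a b u) :
    ∃ C, ∀ t ∈ Icc a b, ‖u t‖ ≤ C := by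
  refine isCompact_Icc.induction_on (p := fun s => ∃ C, ∀ t ∈ s, ‖u t‖ ≤ C) ⟨0, by simp⟩
    (fun s t hst ⟨C, hC⟩ => ⟨C, fun x hx => hC x (hst hx)⟩)
    (fun s t ⟨C, hC⟩ ⟨D, hD⟩ => ⟨max C D, fun x hx => hx.elim
      (fun h => (hC x h).trans (le_max_left _ _)) (fun h => (hD x h).trans (le_max_right _ _))⟩)
    fun t ht => ?_
  have hleft : ∃ C, ∀ᶠ s in 𝓝[Icc a b ∩ Iio t] t, ‖u s‖ ≤ C := by
    rcases ht.1.eq_or_lt with rfl | hat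
    · refine ⟨0, ?_⟩
      have : Icc a b ∩ Iio a = ∅ := by
        ext s; simp only [mem_inter_iff, mem_Icc, mem_Iio, mem_empty_iff_false, iff_false]
        rintro ⟨⟨h1, -⟩, h2⟩; exact absurd h1 (not_le.2 h2)
      simp [this]
    · obtain ⟨l, hl⟩ := hu.left_limit t ⟨hat, ht.2⟩
      refine ⟨‖l‖ + 1, nhdsWithin_mono t inter_subset_right ?_⟩
      exact (hl.norm.eventually (gt_mem_nhds (lt_add_one ‖l‖))).mono fun s hs => le_of_lt hs
  have hright : ∃ C, ∀ᶠ s in 𝓝[Icc a b ∩ Ioi t] t, ‖u s‖ ≤ C := by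
    rcases ht.2.eq_or_lt with rfl | htb
    · refine ⟨0, ?_⟩
      have : Icc a t ∩ Ioi t = ∅ := by
        ext s; simp only [mem_inter_iff, mem_Icc, mem_Ioi, mem_empty_iff_false, iff_false]
        rintro ⟨⟨-, h1⟩, h2⟩; exact absurd h1 (not_le.2 h2)
      simp [this]
    · obtain ⟨l, hl⟩ := hu.right_limit t ⟨ht.1, htb⟩
      refine ⟨‖l‖ + 1, nhdsWithin_mono t inter_subset_right ?_⟩
      exact (hl.norm.eventually (gt_mem_nhds (lt_add_one ‖l‖))).mono fun s hs => le_of_lt hs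
  obtain ⟨C, hC⟩ := hleft
  obtain ⟨D, hD⟩ := hright
  rw [eventually_nhdsWithin_iff] at hC hD
  refine ⟨{s | ‖u s‖ ≤ max (max C D) ‖u t‖}, ?_, max (max C D) ‖u t‖, fun _ => id⟩
  · change ∀ᶠ s in 𝓝[Icc a b] t, ‖u s‖ ≤ max (max C D) ‖u t‖
    rw [eventually_nhdsWithin_iff]
    filter_upwards [hC, hD] with s h1 h2 hs
    rcases lt_trichotomy s t with h | h | h
    · exact (h1 ⟨hs, h⟩).trans (le_trans (le_max_left _ _) (le_max_left _ _))
    · rw [h]; exact le_max_right _ _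
    · exact (h2 ⟨hs, h⟩).trans (le_trans (le_max_right _ _) (le_max_left _ _))

lemma IsPiecewiseContinuous.aestronglyMeasurable {u : ℝ → F}
    (hu : IsPiecewiseContinuous a b u) :
    AEStronglyMeasurable u (volume.restrict (Icc a b)) := by
  obtain ⟨S, hS⟩ := hu.continuous_off_finite
  have h : AEStronglyMeasurable u (volume.restrict (Icc a b \ S)) :=
    ContinuousOn.aestronglyMeasurable (fun t ht => (hS t ht.1 ht.2).mono sdiff_subset)
      (measurableSet_Icc.diff S.measurableSet)
  rwa [Measure.restrict_congr_set
    (sdiff_null_ae_eq_self (S.finite_toSet.measure_zero volume))] at h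

lemma IsPiecewiseContinuous.integrableOn {u : ℝ → F} (hu : IsPiecewiseContinuous a b u) :
    IntegrableOn u (Icc a b) := by
  obtain ⟨C, hC⟩ := hu.exists_bound
  exact IntegrableOn.of_bound (by simp) hu.aestronglyMeasurable C
    ((ae_restrict_iff' measurableSet_Icc).2 (ae_of_all _ hC))

lemma IsPiecewiseContinuous.intervalIntegrable {u : ℝ → F} (hu : IsPiecewiseContinuous a b u)
    {s t : ℝ} (hs : s ∈ Icc a b) (ht : t ∈ Icc a b) : IntervalIntegrable u volume s t :=
  ((hu.integrableOn.mono_set (uIcc_subset_Icc hs ht))).intervalIntegrable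

variable [NormedSpace ℝ F]

lemma IsPiecewiseContinuous.smul {c : ℝ → ℝ} {u : ℝ → F} (hc : IsPiecewiseContinuous a b c)
    (hu : IsPiecewiseContinuous a b u) : IsPiecewiseContinuous a b (fun t => c t • u t) :=
  (hc.prodMk hu).comp_continuous (Φ := fun p : ℝ × F => p.1 • p.2) (by fun_prop)

/-- The fundamental theorem of calculus for a continuous primitive off finitely many points. -/
lemma IsPiecewiseContinuous.integral_eq_sub [CompleteSpace F] {u v : ℝ → F}
    (hu : IsPiecewiseContinuous a b u) (hv : ContinuousOn v (Icc a b)) {S : Finset ℝ}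
    (hd : ∀ t ∈ Icc a b, t ∉ S → HasDerivWithinAt v (u t) (Icc a b) t) {s t : ℝ}
    (hs : s ∈ Icc a b) (ht : t ∈ Icc a b) : ∫ θ in s..t, u θ = v t - v s := by
  refine integral_eq_of_hasDerivAt_off_countable v u (s := S) S.countable_toSet
    (hv.mono (uIcc_subset_Icc hs ht)) (fun θ hθ => ?_) (hu.intervalIntegrable hs ht)
  have hθ' : θ ∈ Ioo a b := ⟨(le_min hs.1 ht.1).trans_lt hθ.1.1,
    hθ.1.2.trans_le (max_le hs.2 ht.2)⟩
  exact (hd θ (Ioo_subset_Icc_self hθ') hθ.2).hasDerivAt (Icc_mem_nhds hθ'.1 hθ'.2)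

lemma IsPiecewiseContinuous.continuousOn_integral_left {u : ℝ → F}
    (hu : IsPiecewiseContinuous a b u) (hab : a ≤ b) :
    ContinuousOn (fun t => ∫ θ in t..b, u θ) (Icc a b) := by
  have := intervalIntegral.continuousOn_primitive_interval_left (μ := volume) (f := u)
    (a := a) (b := b) (by rw [uIcc_of_le hab]; exact hu.integrableOn)
  rwa [uIcc_of_le hab] at this

lemma IsPiecewiseContinuous.continuousOn_integral_right {u : ℝ → F}
    (hu : IsPiecewiseContinuous a b u) (hab : a ≤ b) :
    ContinuousOn (fun t => ∫ θ in a..t, u θ) (Icc a b) := by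
  have := intervalIntegral.continuousOn_primitive_interval (μ := volume) (f := u)
    (a := a) (b := b) (by rw [uIcc_of_le hab]; exact hu.integrableOn)
  rwa [uIcc_of_le hab] at this

lemma IsPiecewiseContinuous.hasDerivWithinAt_integral_left [CompleteSpace F] {u : ℝ → F}
    (hu : IsPiecewiseContinuous a b u) {t : ℝ} (ht : t ∈ Icc a b)
    (hc : ContinuousWithinAt u (Icc a b) t) :
    HasDerivWithinAt (fun s => ∫ θ in s..b, u θ) (-u t) (Icc a b) t := by
  have : Fact (t ∈ Icc a b) := ⟨ht⟩
  exact intervalIntegral.integral_hasDerivWithinAt_left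
    (hu.intervalIntegrable ht ⟨ht.1.trans ht.2, le_rfl⟩) (t := Icc a b)
    ⟨Icc a b, self_mem_nhdsWithin, hu.aestronglyMeasurable⟩ hc

lemma IsPiecewiseContinuous.hasDerivWithinAt_integral_right [CompleteSpace F] {u : ℝ → F}
    (hu : IsPiecewiseContinuous a b u) {t : ℝ} (ht : t ∈ Icc a b)
    (hc : ContinuousWithinAt u (Icc a b) t) :
    HasDerivWithinAt (fun s => ∫ θ in a..s, u θ) (u t) (Icc a b) t := by
  have : Fact (t ∈ Icc a b) := ⟨ht⟩
  exact intervalIntegral.integral_hasDerivWithinAt_right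
    (hu.intervalIntegrable ⟨le_rfl, ht.1.trans ht.2⟩ ht) (t := Icc a b)
    ⟨Icc a b, self_mem_nhdsWithin, hu.aestronglyMeasurable⟩ hc

/-- A continuous function with a piecewise continuous derivative off a finite set is `PC^1`. -/
lemma isPC_one_of_hasDerivWithinAt (hab : a < b) {u v : ℝ → F} (hu : IsPiecewiseContinuous a b u)
    (hv : ContinuousOn v (Icc a b)) (S : Finset ℝ)
    (hd : ∀ t ∈ Icc a b, t ∉ S → HasDerivWithinAt v (u t) (Icc a b) t) : IsPC 1 a b v := by
  refine ⟨fun k hk => ?_, ⟨S, fun k hk t ht htS => ?_⟩, ?_⟩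
  · obtain rfl : k = 0 := by omega
    exact_mod_cast contDiffOn_zero.2 hv
  · obtain rfl : k = 0 := by omega
    simpa using (hd t ht htS).differentiableWithinAt
  · refine hu.congr_off_finite S fun t ht htS => ?_
    rw [iteratedDerivWithin_one]
    exact ((hd t ht htS).derivWithin (uniqueDiffOn_Icc hab t ht)).symm

/-! ### The derivative of top order of a `PC^n` function -/

lemma IsPC.continuousOn_iteratedDerivWithin {n : ℕ} (hab : a < b) {x : ℝ → F} (hx : IsPC n a b x)
    {k : ℕ} (hk : k < n) : ContinuousOn (iteratedDerivWithin k x (Icc a b)) (Icc a b) :=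
  (hx.contDiffOn k hk).continuousOn_iteratedDerivWithin le_rfl (uniqueDiffOn_Icc hab)

/-- At a point where the derivative of top order exists it is continuous: the one-sided limits of
a derivative are one-sided derivatives, hence agree with the derivative. -/
lemma IsPC.continuousWithinAt_of_differentiableWithinAt {n : ℕ} (hab : a < b) {x : ℝ → F}
    (hx : IsPC (n + 1) a b x) {t : ℝ} (ht : t ∈ Icc a b)
    (hd : DifferentiableWithinAt ℝ (iteratedDerivWithin n x (Icc a b)) (Icc a b) t) :
    ContinuousWithinAt (iteratedDerivWithin (n + 1) x (Icc a b)) (Icc a b) t := by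
  set g := iteratedDerivWithin n x (Icc a b) with hg
  have hu := hx.piecewiseContinuous
  have hgc : ContinuousOn g (Icc a b) := hx.continuousOn_iteratedDerivWithin hab (Nat.lt_succ_self n)
  obtain ⟨S, hS⟩ := hx.differentiable_off_finite
  rw [iteratedDerivWithin_succ, ← hg] at hu ⊢
  have hdiff : ∀ s ∈ Ioo a b, s ∉ S → HasDerivAt g (derivWithin g (Icc a b) s) s :=
    fun s hs hsS => (hS n (Nat.lt_succ_self n) s (Ioo_subset_Icc_self hs) hsS).hasDerivWithinAt
      |>.hasDerivAt (Icc_mem_nhds hs.1 hs.2)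
  have hR : ContinuousWithinAt (derivWithin g (Icc a b)) (Icc a b ∩ Ioi t) t := by
    rcases ht.2.eq_or_lt with h | htb
    · have : Icc a b ∩ Ioi t = ∅ := by
        ext s; simp only [mem_inter_iff, mem_Icc, mem_Ioi, mem_empty_iff_false, iff_false]
        rintro ⟨⟨-, h1⟩, h2⟩; linarith
      rw [this, ContinuousWithinAt, nhdsWithin_empty]; exact tendsto_bot
    · obtain ⟨l, hl⟩ := hu.right_limit t ⟨ht.1, htb⟩
      have hmem : Ioo t b ∩ {s | s ∉ S} ∈ 𝓝[>] t :=
        inter_mem (Ioo_mem_nhdsGT htb) (nhdsGT_le_nhdsNE t (eventually_notMem_nhdsNE S t))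
      have hsub : ∀ s ∈ Ioo t b ∩ {s | s ∉ S}, HasDerivAt g (derivWithin g (Icc a b) s) s :=
        fun s hs => hdiff s ⟨ht.1.trans_lt hs.1.1, hs.1.2⟩ hs.2
      have h1 : HasDerivWithinAt g l (Ici t) t := by
        refine hasDerivWithinAt_Ici_of_tendsto_deriv
          (fun s hs => (hsub s hs).differentiableAt.differentiableWithinAt)
          ((hgc t ht).mono fun s hs => ⟨ht.1.trans hs.1.1.le, hs.1.2.le⟩) hmem (hl.congr' ?_)
        filter_upwards [hmem] with s hs using (hsub s hs).deriv.symm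
      have h2 : HasDerivWithinAt g (derivWithin g (Icc a b) t) (Icc t b) t :=
        hd.hasDerivWithinAt.mono (Icc_subset_Icc_left ht.1)
      have : l = derivWithin g (Icc a b) t :=
        (uniqueDiffOn_Icc htb t ⟨le_rfl, htb.le⟩).eq_deriv _ (h1.mono Icc_subset_Ici_self) h2
      rw [this] at hl
      exact hl.mono_left (nhdsWithin_mono t inter_subset_right)
  have hL : ContinuousWithinAt (derivWithin g (Icc a b)) (Icc a b ∩ Iio t) t := by
    rcases ht.1.eq_or_lt with h | hat
    · have : Icc a b ∩ Iio t = ∅ := by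
        ext s; simp only [mem_inter_iff, mem_Icc, mem_Iio, mem_empty_iff_false, iff_false]
        rintro ⟨⟨h1, -⟩, h2⟩; linarith
      rw [this, ContinuousWithinAt, nhdsWithin_empty]; exact tendsto_bot
    · obtain ⟨l, hl⟩ := hu.left_limit t ⟨hat, ht.2⟩
      have hmem : Ioo a t ∩ {s | s ∉ S} ∈ 𝓝[<] t :=
        inter_mem (Ioo_mem_nhdsLT hat) (nhdsLT_le_nhdsNE t (eventually_notMem_nhdsNE S t))
      have hsub : ∀ s ∈ Ioo a t ∩ {s | s ∉ S}, HasDerivAt g (derivWithin g (Icc a b) s) s :=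
        fun s hs => hdiff s ⟨hs.1.1, hs.1.2.trans_le ht.2⟩ hs.2
      have h1 : HasDerivWithinAt g l (Iic t) t := by
        refine hasDerivWithinAt_Iic_of_tendsto_deriv
          (fun s hs => (hsub s hs).differentiableAt.differentiableWithinAt)
          ((hgc t ht).mono fun s hs => ⟨hs.1.1.le, hs.1.2.le.trans ht.2⟩) hmem (hl.congr' ?_)
        filter_upwards [hmem] with s hs using (hsub s hs).deriv.symm
      have h2 : HasDerivWithinAt g (derivWithin g (Icc a b) t) (Icc a t) t :=
        hd.hasDerivWithinAt.mono (Icc_subset_Icc_right ht.2)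
      have : l = derivWithin g (Icc a b) t :=
        (uniqueDiffOn_Icc hat t ⟨hat.le, le_rfl⟩).eq_deriv _ (h1.mono Icc_subset_Iic_self) h2
      rw [this] at hl
      exact hl.mono_left (nhdsWithin_mono t inter_subset_right)
  refine ((hL.union hR).union (continuousWithinAt_singleton (x := t))).mono fun s hs => ?_
  rcases lt_trichotomy s t with h | h | h
  exacts [Or.inl (Or.inl ⟨hs, h⟩), Or.inr h, Or.inl (Or.inr ⟨hs, h⟩)]

end PiecewiseContinuity

/-! ### A Volterra integral equation -/

/-- A Volterra equation with an integrand that is Lipschitz in the unknown has a continuous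
solution, controlled by the size of the integrand at `0`. In terms of `v = exp (-2Kt) u`
the integral operator contracts by the factor `1/2` in the maximum norm. -/
lemma exists_integral_equation_solution {a b : ℝ} (hab : a ≤ b) {K δ : ℝ} (hK : 0 < K)
    (hδ : 0 ≤ δ) (g : ℝ → ℝ → ℝ) (hLip : ∀ t ∈ Icc a b, ∀ u v, |g t u - g t v| ≤ K * |u - v|)
    (h0 : ∀ t ∈ Icc a b, |g t 0| ≤ δ)
    (hpc : ∀ u : ℝ → ℝ, Continuous u → IsPiecewiseContinuous a b (fun t => g t (u t))) :
    ∃ u : ℝ → ℝ, Continuous u ∧ (∀ t ∈ Icc a b, u t = ∫ θ in a..t, g θ (u θ)) ∧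
      ∀ t ∈ Icc a b, |u t| ≤ 2 * (b - a) * Real.exp (2 * K * (b - a)) * δ := by
  -- the unknown `u` recovered from the unknown `v` of the weighted equation
  let U : C(Icc a b, ℝ) → ℝ → ℝ :=
    fun v t => Real.exp (2 * K * (t - a)) * IccExtend hab v t
  have hU : ∀ v, Continuous (U v) := fun v =>
    (by fun_prop : Continuous fun t : ℝ => Real.exp (2 * K * (t - a))).mul
      (v.continuous.Icc_extend' )
  let T : C(Icc a b, ℝ) → C(Icc a b, ℝ) := fun v =>
    ⟨fun t => Real.exp (-(2 * K * ((t : ℝ) - a))) * ∫ θ in a..(t : ℝ), g θ (U v θ), by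
      refine Continuous.mul (by fun_prop) ?_
      exact continuousOn_iff_continuous_domRestrict.1
        ((hpc _ (hU v)).continuousOn_integral_right hab)⟩
  have haI : a ∈ Icc a b := ⟨le_rfl, hab⟩
  have hT : ContractingWith (1 / 2) T := by
    refine ⟨by norm_num, LipschitzWith.of_dist_le_mul fun v w => ?_⟩
    refine (ContinuousMap.dist_le (by positivity)).2 fun t => ?_
    have hbd : ‖∫ θ in a..(t : ℝ), (g θ (U v θ) - g θ (U w θ))‖ ≤
        ∫ θ in a..(t : ℝ), K * dist v w * Real.exp (2 * K * (θ - a)) := by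
      refine intervalIntegral.norm_integral_le_of_norm_le t.2.1 (ae_of_all _ fun θ hθ => ?_)
        (Continuous.intervalIntegrable (by fun_prop) _ _)
      have hθ' : θ ∈ Icc a b := ⟨hθ.1.le, hθ.2.trans t.2.2⟩
      have h1 := hLip θ hθ' (U v θ) (U w θ)
      have h2 : |IccExtend hab v θ - IccExtend hab w θ| ≤ dist v w := by
        rw [IccExtend_of_mem hab v hθ', IccExtend_of_mem hab w hθ', ← Real.dist_eq]
        exact ContinuousMap.dist_apply_le_dist _
      have h3 : |U v θ - U w θ| ≤ Real.exp (2 * K * (θ - a)) * dist v w := by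
        simp only [U, ← mul_sub, abs_mul, abs_of_pos (Real.exp_pos _)]
        gcongr
      rw [Real.norm_eq_abs]
      calc _ ≤ K * (Real.exp (2 * K * (θ - a)) * dist v w) := h1.trans (by gcongr)
        _ = _ := by ring
    have hint : ∫ θ in a..(t : ℝ), K * dist v w * Real.exp (2 * K * (θ - a)) =
        dist v w / 2 * (Real.exp (2 * K * (t - a)) - 1) := by
      have : ∀ θ ∈ uIcc a (t : ℝ), HasDerivAt
          (fun θ => dist v w / 2 * Real.exp (2 * K * (θ - a)))
          (K * dist v w * Real.exp (2 * K * (θ - a))) θ := fun θ _ => by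
        refine (((((hasDerivAt_id θ).sub_const a).const_mul (2 * K)).exp).const_mul
          (dist v w / 2)).congr_deriv ?_
        simp only [id]; ring
      rw [intervalIntegral.integral_eq_sub_of_hasDerivAt this
        (Continuous.intervalIntegrable (by fun_prop) _ _)]
      simp; ring
    have hsub : dist (T v t) (T w t) = Real.exp (-(2 * K * ((t : ℝ) - a))) *
        ‖∫ θ in a..(t : ℝ), (g θ (U v θ) - g θ (U w θ))‖ := by
      rw [intervalIntegral.integral_sub ((hpc _ (hU v)).intervalIntegrable haI t.2)
        ((hpc _ (hU w)).intervalIntegrable haI t.2), Real.dist_eq, Real.norm_eq_abs]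
      simp only [T, ContinuousMap.coe_mk, ← mul_sub, abs_mul, abs_of_pos (Real.exp_pos _)]
    rw [hsub]
    calc _ ≤ Real.exp (-(2 * K * ((t : ℝ) - a))) *
          (dist v w / 2 * (Real.exp (2 * K * (t - a)) - 1)) := by rw [← hint]; gcongr
      _ = dist v w / 2 * (1 - Real.exp (-(2 * K * ((t : ℝ) - a)))) := by
        have : Real.exp (-(2 * K * ((t : ℝ) - a))) * Real.exp (2 * K * (t - a)) = 1 := by
          rw [← Real.exp_add]; simp
        linear_combination dist v w / 2 * this
      _ ≤ dist v w / 2 * 1 := by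
        gcongr; linarith [Real.exp_pos (-(2 * K * ((t : ℝ) - a)))]
      _ = _ := by norm_num; ring
  have : Nonempty C(Icc a b, ℝ) := ⟨0⟩
  let v := ContractingWith.fixedPoint T hT
  have hv : T v = v := hT.fixedPoint_isFixedPt
  have hnorm : ∀ t : Icc a b, |v t| ≤ 2 * (b - a) * δ := by
    intro t
    have h1 : dist 0 (T 0) ≤ (b - a) * δ := by
      refine (ContinuousMap.dist_le (mul_nonneg (sub_nonneg.2 hab) hδ)).2 fun t => ?_
      have hU0 : U 0 = 0 := by ext θ; simp [U, IccExtend]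
      have h2 : ‖∫ θ in a..(t : ℝ), g θ (U 0 θ)‖ ≤ δ * |(t : ℝ) - a| := by
        refine intervalIntegral.norm_integral_le_of_norm_le_const fun θ hθ => ?_
        rw [uIoc_of_le t.2.1] at hθ
        rw [hU0]; exact h0 θ ⟨hθ.1.le, hθ.2.trans t.2.2⟩
      rw [dist_comm, Real.dist_eq]
      simp only [T, ContinuousMap.coe_mk, ContinuousMap.zero_apply, sub_zero, abs_mul,
        abs_of_pos (Real.exp_pos _)]
      rw [Real.norm_eq_abs, abs_of_nonneg (sub_nonneg.2 t.2.1)] at h2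
      have h3 : Real.exp (-(2 * K * ((t : ℝ) - a))) ≤ 1 := Real.exp_le_one_iff.2 (by
        have := sub_nonneg.2 t.2.1; have := mul_nonneg hK.le this; linarith)
      calc _ ≤ 1 * (δ * ((t : ℝ) - a)) := by gcongr
        _ ≤ 1 * (δ * (b - a)) := by gcongr; exact t.2.2
        _ = _ := by ring
    have h2 := hT.dist_fixedPoint_le 0
    have h3 : dist (v t) ((0 : C(Icc a b, ℝ)) t) ≤ dist v 0 := ContinuousMap.dist_apply_le_dist t
    rw [Real.dist_eq, ContinuousMap.zero_apply, sub_zero, dist_comm] at h3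
    refine h3.trans (h2.trans ?_)
    have h4 : 1 - (((1 / 2 : NNReal)) : ℝ) = 1 / 2 := by norm_num
    rw [h4]; linarith
  refine ⟨U v, hU v, fun t ht => ?_, fun t ht => ?_⟩
  · have h1 : T v ⟨t, ht⟩ = v ⟨t, ht⟩ := by rw [hv]
    simp only [T, ContinuousMap.coe_mk] at h1
    change Real.exp (2 * K * (t - a)) * IccExtend hab v t = _
    rw [IccExtend_of_mem hab v ht, ← h1, ← mul_assoc, ← Real.exp_add]
    simp
  · change |Real.exp (2 * K * (t - a)) * IccExtend hab v t| ≤ _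
    rw [IccExtend_of_mem hab v ht, abs_mul, abs_of_pos (Real.exp_pos _)]
    calc _ ≤ Real.exp (2 * K * (b - a)) * (2 * (b - a) * δ) := by
          gcongr
          exacts [ht.2, hnorm _]
      _ = _ := by ring

variable {m n : ℕ} {a b : ℝ}

/-! ### Smooth perturbations of a `PC^n` function -/

section Perturbation

variable {F : Type*} [NormedAddCommGroup F] [NormedSpace ℝ F]

lemma iteratedDerivWithin_eq_iteratedDeriv_of_contDiff (hab : a < b) {G : ℝ → F}
    (hG : ContDiff ℝ ∞ G) (k : ℕ) {t : ℝ} (ht : t ∈ Icc a b) :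
    iteratedDerivWithin k G (Icc a b) t = iteratedDeriv k G t :=
  iteratedDerivWithin_eq_iteratedDeriv (uniqueDiffOn_Icc hab)
    ((hG.of_le (by exact_mod_cast le_top)).contDiffAt) ht

lemma continuous_iteratedDeriv_of_contDiff {G : ℝ → F} (hG : ContDiff ℝ ∞ G) (k : ℕ) :
    Continuous (iteratedDeriv k G) :=
  hG.continuous_iteratedDeriv k (by exact_mod_cast le_top)

lemma hasDerivAt_iteratedDeriv_of_contDiff {G : ℝ → F} (hG : ContDiff ℝ ∞ G) (k : ℕ) (t : ℝ) :
    HasDerivAt (iteratedDeriv k G) (iteratedDeriv (k + 1) G t) t := by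
  rw [iteratedDeriv_succ]
  exact (hG.differentiable_iteratedDeriv k (by exact_mod_cast WithTop.coe_lt_top _) t).hasDerivAt

lemma IsPC.iteratedDerivWithin_add (hab : a < b) {x G : ℝ → F} (hx : IsPC n a b x)
    (hG : ContDiff ℝ ∞ G) {k : ℕ} (hk : k < n) {t : ℝ} (ht : t ∈ Icc a b) :
    iteratedDerivWithin k (x + G) (Icc a b) t =
      iteratedDerivWithin k x (Icc a b) t + iteratedDeriv k G t := by
  rw [_root_.iteratedDerivWithin_add ht (uniqueDiffOn_Icc hab) (hx.contDiffOn k hk t ht)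
    ((hG.of_le (by exact_mod_cast le_top)).contDiffWithinAt),
    iteratedDerivWithin_eq_iteratedDeriv_of_contDiff hab hG k ht]

lemma IsPC.hasDerivWithinAt_iteratedDerivWithin_add (hab : a < b) {x G : ℝ → F}
    (hx : IsPC n a b x) (hG : ContDiff ℝ ∞ G) {k : ℕ} (hk : k < n) {t : ℝ} (ht : t ∈ Icc a b)
    (hd : DifferentiableWithinAt ℝ (iteratedDerivWithin k x (Icc a b)) (Icc a b) t) :
    HasDerivWithinAt (iteratedDerivWithin k (x + G) (Icc a b))
      (iteratedDerivWithin (k + 1) x (Icc a b) t + iteratedDeriv (k + 1) G t) (Icc a b) t := by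
  rw [iteratedDerivWithin_succ]
  refine (hd.hasDerivWithinAt.add
    (hasDerivAt_iteratedDeriv_of_contDiff hG k t).hasDerivWithinAt).congr
    (fun s hs => hx.iteratedDerivWithin_add hab hG hk hs) (hx.iteratedDerivWithin_add hab hG hk ht)

/-- Adding a smooth function adds the derivatives of all orders `k ≤ n`, off a finite set. -/
lemma IsPC.exists_iteratedDerivWithin_add (hab : a < b) {x G : ℝ → F} (hx : IsPC n a b x)
    (hG : ContDiff ℝ ∞ G) : ∃ S : Finset ℝ, ∀ k ≤ n, ∀ t ∈ Icc a b, t ∉ S →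
      iteratedDerivWithin k (x + G) (Icc a b) t =
        iteratedDerivWithin k x (Icc a b) t + iteratedDeriv k G t := by
  obtain ⟨S, hS⟩ := hx.differentiable_off_finite
  refine ⟨S, fun k hk t ht htS => ?_⟩
  rcases hk.lt_or_eq with hk | rfl
  · exact hx.iteratedDerivWithin_add hab hG hk ht
  · cases k with
    | zero => simp
    | succ k =>
      rw [iteratedDerivWithin_succ]
      exact (hx.hasDerivWithinAt_iteratedDerivWithin_add hab hG (Nat.lt_succ_self k) ht
        (hS k (Nat.lt_succ_self k) t ht htS)).derivWithin (uniqueDiffOn_Icc hab t ht)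

lemma IsPC.add_contDiff (hab : a < b) {x G : ℝ → F} (hx : IsPC n a b x)
    (hG : ContDiff ℝ ∞ G) : IsPC n a b (x + G) := by
  refine ⟨fun k hk => (hx.contDiffOn k hk).add
    ((hG.of_le (by exact_mod_cast le_top)).contDiffOn), ?_, ?_⟩
  · obtain ⟨S, hS⟩ := hx.differentiable_off_finite
    exact ⟨S, fun k hk t ht htS => (hx.hasDerivWithinAt_iteratedDerivWithin_add hab hG hk ht
      (hS k hk t ht htS)).differentiableWithinAt⟩
  · obtain ⟨S, hS⟩ := hx.exists_iteratedDerivWithin_add hab hG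
    exact (hx.piecewiseContinuous.add (isPiecewiseContinuous_of_continuousOn
      (continuous_iteratedDeriv_of_contDiff hG n).continuousOn)).congr_off_finite S
      fun t ht htS => (hS n le_rfl t ht htS).symm

end Perturbation

/-! ### The Lagrangian and its partial derivatives -/

/-- The domain `[a,b] × (ℝ^m)^(n+1) × ℝ` of the Lagrangian. -/
abbrev jetDomain (m n : ℕ) (a b : ℝ) : Set (Jet m n) := Icc a b ×ˢ univ

lemma isClosed_jetDomain : IsClosed (jetDomain m n a b) := isClosed_Icc.prod isClosed_univ

lemma uniqueDiffOn_jetDomain (hab : a < b) : UniqueDiffOn ℝ (jetDomain m n a b) :=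
  (uniqueDiffOn_Icc hab).prod uniqueDiffOn_univ

lemma hasFDerivWithinAt_lagrangian {L : Jet m n → ℝ} (hL : ContDiffOn ℝ 1 L (jetDomain m n a b))
    {p : Jet m n} (hp : p ∈ jetDomain m n a b) :
    HasFDerivWithinAt L (fderivWithin ℝ L (jetDomain m n a b) p) (jetDomain m n a b) p :=
  (hL.differentiableOn one_ne_zero p hp).hasFDerivWithinAt

lemma continuousOn_fderivWithin_lagrangian (hab : a < b) {L : Jet m n → ℝ}
    (hL : ContDiffOn ℝ 1 L (jetDomain m n a b)) :
    ContinuousOn (fderivWithin ℝ L (jetDomain m n a b)) (jetDomain m n a b) :=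
  hL.continuousOn_fderivWithin (uniqueDiffOn_jetDomain hab) le_rfl

lemma partialZ_eq_fderivWithin {L : Jet m n → ℝ} (hL : ContDiffOn ℝ 1 L (jetDomain m n a b))
    {p : Jet m n} (hp : p ∈ jetDomain m n a b) :
    partialZ L p = fderivWithin ℝ L (jetDomain m n a b) p (0, 0, 1) := by
  have h1 : HasDerivAt (fun w : ℝ => ((p.1, p.2.1, w) : Jet m n)) (0, 0, 1) p.2.2 :=
    (hasDerivAt_const _ _).prodMk ((hasDerivAt_const _ _).prodMk (hasDerivAt_id _))
  have h2 := (hasFDerivWithinAt_lagrangian hL hp).comp_hasDerivWithinAt_of_eq p.2.2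
    (h1.hasDerivWithinAt (s := univ)) (fun w _ => ⟨hp.1, mem_univ _⟩) rfl
  rw [hasDerivWithinAt_univ] at h2
  exact h2.deriv

/-- The partial gradient represents the derivative of the Lagrangian along the `j`-th slot. -/
lemma partialX_eq_toDual_symm {L : Jet m n → ℝ} (hL : ContDiffOn ℝ 1 L (jetDomain m n a b))
    {p : Jet m n} (hp : p ∈ jetDomain m n a b) (j : Fin (n + 1)) :
    partialX L j p = (InnerProductSpace.toDual ℝ (EuclideanSpace ℝ (Fin m))).symm
      ((fderivWithin ℝ L (jetDomain m n a b) p).comp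
        ((ContinuousLinearMap.inr ℝ ℝ _).comp ((ContinuousLinearMap.inl ℝ _ ℝ).comp
          (ContinuousLinearMap.single ℝ (fun _ : Fin (n + 1) => EuclideanSpace ℝ (Fin m)) j)))) := by
  have h1 : HasFDerivAt
      (fun y : EuclideanSpace ℝ (Fin m) =>
        ((p.1, Function.update p.2.1 j y, p.2.2) : Jet m n))
      ((ContinuousLinearMap.inr ℝ ℝ _).comp ((ContinuousLinearMap.inl ℝ _ ℝ).comp
          (ContinuousLinearMap.single ℝ (fun _ : Fin (n + 1) => EuclideanSpace ℝ (Fin m)) j)))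
      (p.2.1 j) := by
    have h0 := (hasFDerivAt_const (𝕜 := ℝ) p.1 (p.2.1 j)).prodMk
      ((hasFDerivAt_update (𝕜 := ℝ) p.2.1 (i := j) (p.2.1 j)).prodMk
        (hasFDerivAt_const p.2.2 (p.2.1 j)))
    refine h0.congr_fderiv ?_
    ext v i <;> simp [Pi.single_apply]
    split_ifs <;> rfl
  have hg : HasFDerivWithinAt L (fderivWithin ℝ L (jetDomain m n a b) p) (jetDomain m n a b)
      (p.1, Function.update p.2.1 j (p.2.1 j), p.2.2) := by
    rw [Function.update_eq_self]; exact hasFDerivWithinAt_lagrangian hL hp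
  have h2 := HasFDerivWithinAt.comp (t := jetDomain m n a b) (p.2.1 j) hg
    (h1.hasFDerivWithinAt (s := univ)) (fun w _ => ⟨hp.1, mem_univ _⟩)
  rw [hasFDerivWithinAt_univ] at h2
  rw [partialX, dif_pos j.2, gradient]
  congr 1
  exact h2.fderiv

lemma inner_partialX {L : Jet m n → ℝ} (hL : ContDiffOn ℝ 1 L (jetDomain m n a b))
    {p : Jet m n} (hp : p ∈ jetDomain m n a b) (j : Fin (n + 1)) (v : EuclideanSpace ℝ (Fin m)) :
    inner ℝ (partialX L j p) v =
      fderivWithin ℝ L (jetDomain m n a b) p (0, Pi.single j v, 0) := by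
  rw [partialX_eq_toDual_symm hL hp, InnerProductSpace.toDual_symm_apply]
  rfl

lemma continuousOn_partialX (hab : a < b) {L : Jet m n → ℝ}
    (hL : ContDiffOn ℝ 1 L (jetDomain m n a b)) (j : ℕ) :
    ContinuousOn (partialX L j) (jetDomain m n a b) := by
  by_cases hj : j < n + 1
  · refine ContinuousOn.congr ?_ fun p hp => partialX_eq_toDual_symm hL hp ⟨j, hj⟩
    exact (LinearIsometryEquiv.continuous _).comp_continuousOn
      ((continuousOn_fderivWithin_lagrangian hab hL).clm_comp continuousOn_const)
  · refine (continuousOn_const (c := 0)).congr fun p hp => ?_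
    rw [partialX, dif_neg hj]

lemma continuousOn_partialZ (hab : a < b) {L : Jet m n → ℝ}
    (hL : ContDiffOn ℝ 1 L (jetDomain m n a b)) :
    ContinuousOn (partialZ L) (jetDomain m n a b) :=
  ContinuousOn.congr ((continuousOn_fderivWithin_lagrangian hab hL).clm_apply continuousOn_const)
    fun _ hp => partialZ_eq_fderivWithin hL hp

/-- A `C^1` Lagrangian is Lipschitz on bounded parts of its domain. -/
lemma exists_lipschitz_lagrangian (hab : a < b) {L : Jet m n → ℝ}
    (hL : ContDiffOn ℝ 1 L (jetDomain m n a b)) (M : ℝ) :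
    ∃ K > 0, ∀ p ∈ jetDomain m n a b, ∀ q ∈ jetDomain m n a b, ‖p‖ ≤ M → ‖q‖ ≤ M →
      |L p - L q| ≤ K * ‖p - q‖ := by
  have hc : IsCompact (jetDomain m n a b ∩ Metric.closedBall 0 M) :=
    (isCompact_closedBall 0 M).inter_left isClosed_jetDomain
  obtain ⟨K, hK⟩ := hc.exists_bound_of_continuousOn
    ((continuousOn_fderivWithin_lagrangian hab hL).mono inter_subset_left)
  refine ⟨max K 1, by positivity, fun p hp q hq hpM hqM => ?_⟩
  refine Convex.norm_image_sub_le_of_norm_hasFDerivWithin_le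
    (s := jetDomain m n a b ∩ Metric.closedBall 0 M)
    (fun r hr => (hasFDerivWithinAt_lagrangian hL hr.1).mono inter_subset_left)
    (fun r hr => (hK r hr).trans (le_max_left _ _))
    (((convex_Icc a b).prod convex_univ).inter (convex_closedBall 0 M))
    ⟨hq, by simpa using hqM⟩ ⟨hp, by simpa using hpM⟩

/-! ### The quantities along a given pair `(x,z)` -/

section Along

variable {L : Jet m n → ℝ} {x : ℝ → EuclideanSpace ℝ (Fin m)} {z : ℝ → ℝ}

lemma bracket_mem_jetDomain {t : ℝ} (ht : t ∈ Icc a b) :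
    bracket n a b x z t ∈ jetDomain m n a b := ⟨ht, mem_univ _⟩

lemma IsPC.continuousOn (hab : a < b) {F : Type*} [NormedAddCommGroup F] [NormedSpace ℝ F]
    {y : ℝ → F} (hn : 1 ≤ n) (hy : IsPC n a b y) : ContinuousOn y (Icc a b) := by
  simpa using hy.continuousOn_iteratedDerivWithin hab (k := 0) hn

lemma isPiecewiseContinuous_bracket (hab : a < b) (hx : IsPC n a b x) (hz : IsPC 1 a b z) :
    IsPiecewiseContinuous a b (bracket n a b x z) := by
  refine (isPiecewiseContinuous_of_continuousOn continuousOn_id).prodMk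
    ((isPiecewiseContinuous_pi fun k => ?_).prodMk
      (isPiecewiseContinuous_of_continuousOn (hz.continuousOn hab le_rfl)))
  rcases (Nat.lt_succ_iff.1 k.2).lt_or_eq with hk | hk
  · exact isPiecewiseContinuous_of_continuousOn (hx.continuousOn_iteratedDerivWithin hab hk)
  · rw [hk]; exact hx.piecewiseContinuous

lemma continuousWithinAt_bracket (hn : 1 ≤ n) (hab : a < b) (hx : IsPC n a b x)
    (hz : IsPC 1 a b z) {t : ℝ} (ht : t ∈ regularPoints n a b x) :
    ContinuousWithinAt (bracket n a b x z) (Icc a b) t := by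
  refine continuousWithinAt_id.prodMk ((continuousWithinAt_pi.2 fun k => ?_).prodMk
    (hz.continuousOn hab le_rfl t ht.1))
  rcases (Nat.lt_succ_iff.1 k.2).lt_or_eq with hk | hk
  · exact hx.continuousOn_iteratedDerivWithin hab hk t ht.1
  · rw [hk]
    obtain ⟨d, rfl⟩ : ∃ d, n = d + 1 := ⟨n - 1, by omega⟩
    exact hx.continuousWithinAt_of_differentiableWithinAt hab ht.1 ht.2

lemma exists_finset_regularPoints (hn : 1 ≤ n) (hx : IsPC n a b x) :
    ∃ S : Finset ℝ, ∀ t ∈ Icc a b, t ∉ S → t ∈ regularPoints n a b x := by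
  obtain ⟨S, hS⟩ := hx.differentiable_off_finite
  exact ⟨S, fun t ht htS => ⟨ht, hS (n - 1) (by omega) t ht htS⟩⟩

lemma isPiecewiseContinuous_partialZ (hab : a < b) (hL : ContDiffOn ℝ 1 L (jetDomain m n a b))
    (hx : IsPC n a b x) (hz : IsPC 1 a b z) :
    IsPiecewiseContinuous a b (fun t => partialZ L (bracket n a b x z t)) :=
  (isPiecewiseContinuous_bracket hab hx hz).comp_continuousOn isClosed_jetDomain
    (fun _ ht => bracket_mem_jetDomain ht) (continuousOn_partialZ hab hL)

lemma continuousOn_psiZ (hab : a < b) (hL : ContDiffOn ℝ 1 L (jetDomain m n a b))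
    (hx : IsPC n a b x) (hz : IsPC 1 a b z) : ContinuousOn (psiZ n a b L x z) (Icc a b) :=
  Real.continuous_exp.comp_continuousOn
    ((isPiecewiseContinuous_partialZ hab hL hx hz).continuousOn_integral_left hab.le)

lemma hasDerivWithinAt_psiZ (hn : 1 ≤ n) (hab : a < b)
    (hL : ContDiffOn ℝ 1 L (jetDomain m n a b)) (hx : IsPC n a b x) (hz : IsPC 1 a b z) {t : ℝ}
    (ht : t ∈ regularPoints n a b x) :
    HasDerivWithinAt (psiZ n a b L x z)
      (psiZ n a b L x z t * -partialZ L (bracket n a b x z t)) (Icc a b) t := by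
  refine HasDerivWithinAt.exp ((isPiecewiseContinuous_partialZ hab hL hx hz
    ).hasDerivWithinAt_integral_left ht.1 ?_)
  exact ((continuousOn_partialZ hab hL) _ (bracket_mem_jetDomain ht.1)).comp
    (continuousWithinAt_bracket hn hab hx hz ht) fun s hs => bracket_mem_jetDomain hs

lemma isPiecewiseContinuous_momentum (hab : a < b) (hL : ContDiffOn ℝ 1 L (jetDomain m n a b))
    (hx : IsPC n a b x) (hz : IsPC 1 a b z) (j : ℕ) :
    IsPiecewiseContinuous a b (momentum n a b L x z j) :=
  (isPiecewiseContinuous_of_continuousOn (continuousOn_psiZ hab hL hx hz)).smul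
    ((isPiecewiseContinuous_bracket hab hx hz).comp_continuousOn isClosed_jetDomain
      (fun _ ht => bracket_mem_jetDomain ht) (continuousOn_partialX hab hL j))

lemma continuousWithinAt_momentum (hn : 1 ≤ n) (hab : a < b)
    (hL : ContDiffOn ℝ 1 L (jetDomain m n a b)) (hx : IsPC n a b x) (hz : IsPC 1 a b z) (j : ℕ)
    {t : ℝ} (ht : t ∈ regularPoints n a b x) :
    ContinuousWithinAt (momentum n a b L x z j) (Icc a b) t :=
  (continuousOn_psiZ hab hL hx hz t ht.1).smul
    (((continuousOn_partialX hab hL j) _ (bracket_mem_jetDomain ht.1)).comp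
      (continuousWithinAt_bracket hn hab hx hz ht) fun _ hs => bracket_mem_jetDomain hs)

end Along

/-! ### The first variation -/

section FirstVariation

variable {L : Jet m n → ℝ} {x : ℝ → EuclideanSpace ℝ (Fin m)} {z : ℝ → ℝ} {γ : ℝ}

/-- The change of the bracket caused by adding `s • G` to `x` and the value `r` to `z`. -/
noncomputable def jetShift (n : ℕ) (G : ℝ → EuclideanSpace ℝ (Fin m)) (s r t : ℝ) : Jet m n :=
  (0, fun k => s • iteratedDeriv (k : ℕ) G t, r)

/-- The derivatives `(G, G', …, G^(n))` of a curve, as a tangent vector to the space of jets. -/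
noncomputable def curveJet (n : ℕ) (G : ℝ → EuclideanSpace ℝ (Fin m)) (t : ℝ) : Jet m n :=
  (0, fun k => iteratedDeriv (k : ℕ) G t, 0)

lemma jetShift_eq (G : ℝ → EuclideanSpace ℝ (Fin m)) (s r t : ℝ) :
    jetShift n G s r t = s • curveJet n G t + r • ((0, 0, 1) : Jet m n) := by
  refine Prod.ext ?_ (Prod.ext ?_ ?_)
  · simp [jetShift, curveJet]
  · ext k; simp [jetShift, curveJet]
  · simp [jetShift, curveJet]

lemma jetShift_sub (G : ℝ → EuclideanSpace ℝ (Fin m)) (s r r' t : ℝ) :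
    jetShift n G s r t - jetShift n G s r' t = (r - r') • ((0, 0, 1) : Jet m n) := by
  rw [jetShift_eq, jetShift_eq, sub_smul]; abel

lemma norm_vertical (r : ℝ) : ‖r • ((0, 0, 1) : Jet m n)‖ = |r| := by
  simp [Prod.norm_def]

lemma norm_jetShift_le (G : ℝ → EuclideanSpace ℝ (Fin m)) (s r t : ℝ) :
    ‖jetShift n G s r t‖ ≤ |s| * ‖curveJet n G t‖ + |r| := by
  rw [jetShift_eq]
  refine (norm_add_le _ _).trans ?_
  rw [norm_vertical, norm_smul, Real.norm_eq_abs]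

lemma add_jetShift_mem {p : Jet m n} (hp : p ∈ jetDomain m n a b)
    (G : ℝ → EuclideanSpace ℝ (Fin m)) (s r t : ℝ) :
    p + jetShift n G s r t ∈ jetDomain m n a b :=
  ⟨by simpa [jetShift] using hp.1, mem_univ _⟩

lemma continuous_curveJet {G : ℝ → EuclideanSpace ℝ (Fin m)} (hG : ContDiff ℝ ∞ G) :
    Continuous (curveJet n G) :=
  continuous_const.prodMk ((continuous_pi fun k : Fin (n + 1) =>
    continuous_iteratedDeriv_of_contDiff hG (k : ℕ)).prodMk continuous_const)

lemma isPiecewiseContinuous_lagrangian_shift (hab : a < b)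
    (hL : ContDiffOn ℝ 1 L (jetDomain m n a b)) (hx : IsPC n a b x) (hz : IsPC 1 a b z)
    {G : ℝ → EuclideanSpace ℝ (Fin m)} (hG : ContDiff ℝ ∞ G) (s : ℝ) {u : ℝ → ℝ}
    (hu : ContinuousOn u (Icc a b)) :
    IsPiecewiseContinuous a b (fun t => L (bracket n a b x z t + jetShift n G s (u t) t)) := by
  refine ((isPiecewiseContinuous_bracket hab hx hz).add
    (isPiecewiseContinuous_of_continuousOn ?_)).comp_continuousOn isClosed_jetDomain
    (fun t ht => add_jetShift_mem (bracket_mem_jetDomain ht) G s _ t) hL.continuousOn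
  simp only [jetShift_eq]
  have := (continuous_curveJet (n := n) hG).continuousOn (s := Icc a b)
  fun_prop

lemma isPiecewiseContinuous_lagrangian (hab : a < b)
    (hL : ContDiffOn ℝ 1 L (jetDomain m n a b)) (hx : IsPC n a b x) (hz : IsPC 1 a b z) :
    IsPiecewiseContinuous a b (fun t => L (bracket n a b x z t)) :=
  (isPiecewiseContinuous_bracket hab hx hz).comp_continuousOn isClosed_jetDomain
    (fun _ ht => bracket_mem_jetDomain ht) hL.continuousOn

/-- Along the bracket of `(x,z)`, shifts of bounded size change the Lagrangian in a Lipschitz way. -/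
lemma exists_lipschitz_shift (hab : a < b) (hL : ContDiffOn ℝ 1 L (jetDomain m n a b))
    (hx : IsPC n a b x) (hz : IsPC 1 a b z) (M : ℝ) :
    ∃ K > 0, ∀ t ∈ Icc a b, ∀ d e : Jet m n,
      bracket n a b x z t + d ∈ jetDomain m n a b → bracket n a b x z t + e ∈ jetDomain m n a b →
      ‖d‖ ≤ M → ‖e‖ ≤ M →
      |L (bracket n a b x z t + d) - L (bracket n a b x z t + e)| ≤ K * ‖d - e‖ := by
  obtain ⟨C, hC⟩ := (isPiecewiseContinuous_bracket hab hx hz).exists_bound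
  obtain ⟨K, hK, h⟩ := exists_lipschitz_lagrangian hab hL (C + M)
  refine ⟨K, hK, fun t ht d e hd he hdM heM => ?_⟩
  have := h _ hd _ he ((norm_add_le _ _).trans (add_le_add (hC t ht) hdM))
    ((norm_add_le _ _).trans (add_le_add (hC t ht) heM))
  rwa [add_sub_add_left_eq_sub] at this

/-- For small `s` the equation `w' = L` can be solved for the curve `x + s • G` on all of `[a,b]`;
the solution `w = z + u` differs from `z` by `O(s)`. -/
lemma exists_shift_solution (hab : a < b) (hL : ContDiffOn ℝ 1 L (jetDomain m n a b))
    (hx : IsPC n a b x) (hz : IsPC 1 a b z) {G : ℝ → EuclideanSpace ℝ (Fin m)}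
    (hG : ContDiff ℝ ∞ G) :
    ∃ C ≥ 0, ∃ s₀ > 0, ∀ s : ℝ, |s| ≤ s₀ → ∃ u : ℝ → ℝ, Continuous u ∧
      (∀ t ∈ Icc a b, |u t| ≤ C * |s|) ∧ ∀ t ∈ Icc a b, u t = ∫ θ in a..t,
        (L (bracket n a b x z θ + jetShift n G s (u θ) θ) - L (bracket n a b x z θ)) := by
  obtain ⟨B, hB⟩ := isCompact_Icc.exists_bound_of_continuousOn
    ((continuous_curveJet (n := n) hG).continuousOn (s := Icc a b))
  have hB0 : 0 ≤ B := (norm_nonneg _).trans (hB a ⟨le_rfl, hab.le⟩)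
  obtain ⟨K, hK, hLip⟩ := exists_lipschitz_shift hab hL hx hz (B + 1)
  -- the equation is first solved with `u` clamped to `[-1,1]`, where the Lipschitz bound holds
  let clamp : ℝ → ℝ := fun r => projIcc (-1) 1 (by norm_num) r
  have hclamp : ∀ r, |clamp r| ≤ 1 := fun r => abs_le.2 (projIcc (-1) 1 (by norm_num) r).2
  have hclamp_eq : ∀ r, |r| ≤ 1 → clamp r = r := fun r hr => by
    simp only [clamp]; rw [projIcc_of_mem (by norm_num) (abs_le.1 hr)]
  have hclamp_cont : Continuous clamp := continuous_subtype_val.comp continuous_projIcc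
  set C := 2 * (b - a) * Real.exp (2 * K * (b - a)) * (K * B) with hCdef
  have hC0 : 0 ≤ C := by have := sub_nonneg.2 hab.le; positivity
  have hp := fun {t : ℝ} (ht : t ∈ Icc a b) => bracket_mem_jetDomain (n := n) (x := x) (z := z) ht
  -- for `|s| ≤ 1 / (C + 1)` the bound `C * |s|` on the solution is below the clamping threshold
  refine ⟨C, hC0, min 1 (1 / (C + 1)), by positivity, fun s hs => ?_⟩
  have hs1 : |s| ≤ 1 := hs.trans (min_le_left _ _)
  have hsC : C * |s| ≤ 1 := by
    have h1 : |s| * (C + 1) ≤ 1 := (le_div_iff₀ (by positivity)).1 (hs.trans (min_le_right _ _))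
    nlinarith [abs_nonneg s]
  have hsize : ∀ t ∈ Icc a b, ∀ r, ‖jetShift n G s (clamp r) t‖ ≤ B + 1 := fun t ht r => by
    refine (norm_jetShift_le _ _ _ _).trans (add_le_add ?_ (hclamp r))
    calc |s| * ‖curveJet n G t‖ ≤ 1 * B := by gcongr; exact hB t ht
      _ = B := one_mul B
  let g : ℝ → ℝ → ℝ := fun t r =>
    L (bracket n a b x z t + jetShift n G s (clamp r) t) - L (bracket n a b x z t)
  have hg : ∀ t ∈ Icc a b, ∀ r r', |g t r - g t r'| ≤ K * |r - r'| := by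
    intro t ht r r'
    simp only [g]
    rw [sub_sub_sub_cancel_right]
    refine (hLip t ht _ _ (add_jetShift_mem (hp ht) _ _ _ _) (add_jetShift_mem (hp ht) _ _ _ _)
      (hsize t ht r) (hsize t ht r')).trans ?_
    rw [jetShift_sub, norm_vertical]
    exact mul_le_mul_of_nonneg_left
      (abs_projIcc_sub_projIcc (by norm_num : (-1 : ℝ) ≤ 1)) hK.le
  have hg0 : ∀ t ∈ Icc a b, |g t 0| ≤ K * (B * |s|) := by
    intro t ht
    have h1 := hLip t ht (jetShift n G s (clamp 0) t) 0 (add_jetShift_mem (hp ht) _ _ _ _)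
      (by simpa using hp ht) (hsize t ht 0) (by rw [norm_zero]; positivity)
    rw [add_zero, sub_zero] at h1
    refine h1.trans ?_
    gcongr
    refine (norm_jetShift_le _ _ _ _).trans ?_
    rw [hclamp_eq 0 (by simp), abs_zero, add_zero, mul_comm]
    gcongr
    exact hB t ht
  have hgpc : ∀ v : ℝ → ℝ, Continuous v → IsPiecewiseContinuous a b (fun t => g t (v t)) :=
    fun v hv => (isPiecewiseContinuous_lagrangian_shift hab hL hx hz hG s
      (hclamp_cont.comp hv).continuousOn).sub (isPiecewiseContinuous_lagrangian hab hL hx hz)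
  obtain ⟨u, hu, hueq, hub⟩ := exists_integral_equation_solution hab.le hK (by positivity) g hg
    hg0 hgpc
  have hub' : ∀ t ∈ Icc a b, |u t| ≤ C * |s| := fun t ht => (hub t ht).trans_eq (by
    rw [hCdef]; ring)
  refine ⟨u, hu, hub', fun t ht => ?_⟩
  rw [hueq t ht]
  refine intervalIntegral.integral_congr fun θ hθ => ?_
  rw [uIcc_of_le ht.1] at hθ
  simp only [g]
  rw [hclamp_eq (u θ) ((hub' θ ⟨hθ.1, hθ.2.trans ht.2⟩).trans hsC)]

/-- The shifted pair is admissible. -/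
lemma IsAdmissible.shift (hab : a < b) (hL : ContDiffOn ℝ 1 L (jetDomain m n a b))
    (hxz : IsAdmissible n a b γ L x z) {G : ℝ → EuclideanSpace ℝ (Fin m)}
    (hG : ContDiff ℝ ∞ G) {s : ℝ} {u : ℝ → ℝ} (hu : Continuous u)
    (hueq : ∀ t ∈ Icc a b, u t = ∫ θ in a..t,
        (L (bracket n a b x z θ + jetShift n G s (u θ) θ) - L (bracket n a b x z θ))) :
    IsAdmissible n a b γ L (x + s • G) (z + u) := by
  classical
  have hx := hxz.pc_x
  have hz := hxz.pc_z
  have hsG : ContDiff ℝ ∞ (s • G) := contDiff_const.smul hG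
  have hpc1 := isPiecewiseContinuous_lagrangian_shift hab hL hx hz hG s hu.continuousOn
  have hpc := hpc1.sub (isPiecewiseContinuous_lagrangian hab hL hx hz)
  obtain ⟨S₁, hS₁⟩ := hpc.continuous_off_finite
  obtain ⟨S₂, hS₂⟩ := hxz.ode
  obtain ⟨S₃, hS₃⟩ := hx.exists_iteratedDerivWithin_add hab hsG
  have hder : ∀ t ∈ Icc a b, t ∉ S₁ ∪ S₂ → HasDerivWithinAt (z + u)
      (L (bracket n a b x z t + jetShift n G s (u t) t)) (Icc a b) t := by
    intro t ht htS
    rw [Finset.notMem_union] at htS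
    have h1 := (hpc.hasDerivWithinAt_integral_right ht (hS₁ t ht htS.1)).congr hueq (hueq t ht)
    exact ((hS₂ t ht htS.2).add h1).congr_deriv (by ring)
  refine ⟨hx.add_contDiff hab hsG, ?_, ?_, S₁ ∪ S₂ ∪ S₃, fun t ht htS => ?_⟩
  · exact isPC_one_of_hasDerivWithinAt hab hpc1
      ((hz.continuousOn hab le_rfl).add hu.continuousOn) (S₁ ∪ S₂) hder
  · rw [Pi.add_apply, hxz.init_z, hueq a ⟨le_rfl, hab.le⟩, intervalIntegral.integral_same, add_zero]
  · rw [Finset.notMem_union] at htS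
    have : bracket n a b (x + s • G) (z + u) t =
        bracket n a b x z t + jetShift n G s (u t) t := by
      refine Prod.ext ?_ (Prod.ext ?_ ?_)
      · simp [bracket, jetShift]
      · ext1 k
        change iteratedDerivWithin k (x + s • G) (Icc a b) t =
          iteratedDerivWithin k x (Icc a b) t + s • iteratedDeriv k G t
        rw [hS₃ k (Nat.lt_succ_iff.1 k.2) t ht htS.2, iteratedDeriv_const_smul
          ((hG.of_le (by exact_mod_cast le_top)).contDiffAt)]
      · simp [bracket, jetShift]
    rw [this]
    exact hder t ht htS.1

/-- The derivative of the final value `(z + u)(b)` in the direction of the perturbation: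
`ψ_z` is an integrating factor for the linearised equation. -/
lemma tendsto_shift_solution (hn : 1 ≤ n) (hab : a < b)
    (hL : ContDiffOn ℝ 1 L (jetDomain m n a b)) (hx : IsPC n a b x) (hz : IsPC 1 a b z)
    {G : ℝ → EuclideanSpace ℝ (Fin m)} (hG : ContDiff ℝ ∞ G) {C s₀ : ℝ} (hs₀ : 0 < s₀)
    {u : ℝ → ℝ → ℝ} (hC : 0 ≤ C)
    (hu : ∀ s : ℝ, |s| ≤ s₀ → Continuous (u s) ∧
      (∀ t ∈ Icc a b, |u s t| ≤ C * |s|) ∧ ∀ t ∈ Icc a b, u s t = ∫ θ in a..t,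
        (L (bracket n a b x z θ + jetShift n G s (u s θ) θ) - L (bracket n a b x z θ))) :
    Tendsto (fun s => u s b / s) (𝓝[≠] 0) (𝓝 (∫ t in a..b, psiZ n a b L x z t *
      fderivWithin ℝ L (jetDomain m n a b) (bracket n a b x z t) (curveJet n G t))) := by
  classical
  have hp := fun {t : ℝ} (ht : t ∈ Icc a b) => bracket_mem_jetDomain (n := n) (x := x) (z := z) ht
  have haI : a ∈ Icc a b := ⟨le_rfl, hab.le⟩
  have hbI : b ∈ Icc a b := ⟨hab.le, le_rfl⟩
  have hψ := continuousOn_psiZ hab hL hx hz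
  have hA := isPiecewiseContinuous_partialZ hab hL hx hz
  obtain ⟨Cψ, hCψ⟩ := isCompact_Icc.exists_bound_of_continuousOn hψ
  obtain ⟨CA, hCA⟩ := hA.exists_bound
  obtain ⟨B, hB⟩ := isCompact_Icc.exists_bound_of_continuousOn
    ((continuous_curveJet (n := n) hG).continuousOn (s := Icc a b))
  have hB0 : 0 ≤ B := (norm_nonneg _).trans (hB a haI)
  have hCψ0 : 0 ≤ Cψ := (norm_nonneg _).trans (hCψ a haI)
  obtain ⟨K, hK, hLip⟩ := exists_lipschitz_shift hab hL hx hz (s₀ * B + C * s₀)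
  -- the derivative of `ψ_z * u s`
  let D : ℝ → ℝ → ℝ := fun s t => psiZ n a b L x z t *
    (L (bracket n a b x z t + jetShift n G s (u s t) t) - L (bracket n a b x z t) -
      partialZ L (bracket n a b x z t) * u s t)
  have hsmall : ∀ᶠ s in 𝓝[≠] (0 : ℝ), |s| ≤ s₀ ∧ s ≠ 0 := by
    refine Filter.Eventually.and (nhdsWithin_le_nhds ?_) self_mem_nhdsWithin
    filter_upwards [Metric.ball_mem_nhds (0 : ℝ) hs₀] with s hs
    simpa using (mem_ball_zero_iff.1 hs).le
  have hDpc : ∀ s, |s| ≤ s₀ → IsPiecewiseContinuous a b (D s) := fun s hs =>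
    (isPiecewiseContinuous_of_continuousOn hψ).smul
      (((isPiecewiseContinuous_lagrangian_shift hab hL hx hz hG s (hu s hs).1.continuousOn).sub
        (isPiecewiseContinuous_lagrangian hab hL hx hz)).sub
        (hA.smul (isPiecewiseContinuous_of_continuousOn (hu s hs).1.continuousOn)))
  have hint : ∀ s, |s| ≤ s₀ → ∫ t in a..b, D s t = u s b := by
    intro s hs
    obtain ⟨huc, -, hueq⟩ := hu s hs
    have hpc := (isPiecewiseContinuous_lagrangian_shift hab hL hx hz hG s huc.continuousOn).sub
      (isPiecewiseContinuous_lagrangian hab hL hx hz)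
    obtain ⟨S₁, hS₁⟩ := hpc.continuous_off_finite
    obtain ⟨S₂, hS₂⟩ := exists_finset_regularPoints hn hx
    rw [(hDpc s hs).integral_eq_sub (v := fun t => psiZ n a b L x z t * u s t)
      (hψ.mul huc.continuousOn) (S := S₁ ∪ S₂) ?_ haI hbI]
    · rw [hueq a haI, intervalIntegral.integral_same]
      simp [psiZ]
    · intro t ht htS
      rw [Finset.notMem_union] at htS
      have h1 := (hpc.hasDerivWithinAt_integral_right ht (hS₁ t ht htS.1)).congr hueq (hueq t ht)
      refine ((hasDerivWithinAt_psiZ hn hab hL hx hz (hS₂ t ht htS.2)).mul h1).congr_deriv ?_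
      simp only [D]; ring
  have hsize : ∀ s, |s| ≤ s₀ → ∀ t ∈ Icc a b, ‖jetShift n G s (u s t) t‖ ≤ (B + C) * |s| := by
    intro s hs t ht
    refine (norm_jetShift_le _ _ _ _).trans ?_
    have h1 := mul_le_mul_of_nonneg_left (hB t ht) (abs_nonneg s)
    linarith [(hu s hs).2.1 t ht]
  have hlim : Tendsto (fun s => ∫ t in a..b, D s t / s) (𝓝[≠] 0)
      (𝓝 (∫ t in a..b, psiZ n a b L x z t *
        fderivWithin ℝ L (jetDomain m n a b) (bracket n a b x z t) (curveJet n G t))) := by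
    refine intervalIntegral.tendsto_integral_filter_of_dominated_convergence
      (fun _ => Cψ * (K * (B + C) + CA * C)) ?_ ?_ (by simp) ?_
    · filter_upwards [hsmall] with s hs
      rw [uIoc_of_le hab.le]
      have := (hDpc s hs.1).aestronglyMeasurable.mono_measure
        (Measure.restrict_mono Ioc_subset_Icc_self le_rfl)
      simpa only [div_eq_mul_inv] using this.mul_const s⁻¹
    · filter_upwards [hsmall] with s hs
      refine ae_of_all _ fun t ht => ?_
      rw [uIoc_of_le hab.le] at ht
      have ht' := Ioc_subset_Icc_self ht
      have hs0 : 0 < |s| := abs_pos.2 hs.2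
      rw [norm_div, Real.norm_eq_abs s, div_le_iff₀ hs0]
      have h1 : |L (bracket n a b x z t + jetShift n G s (u s t) t) - L (bracket n a b x z t)| ≤
          K * ((B + C) * |s|) := by
        have hsz := hsize s hs.1 t ht'
        have h2 := hLip t ht' (jetShift n G s (u s t) t) 0 (add_jetShift_mem (hp ht') _ _ _ _)
          (by simpa using hp ht') (hsz.trans (by nlinarith [hs.1]))
          (by rw [norm_zero]; positivity)
        rw [add_zero, sub_zero] at h2
        exact h2.trans (by gcongr)
      have h3 : |partialZ L (bracket n a b x z t) * u s t| ≤ CA * (C * |s|) := by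
        rw [abs_mul]
        exact mul_le_mul (hCA t ht') ((hu s hs.1).2.1 t ht') (abs_nonneg _)
          ((norm_nonneg _).trans (hCA t ht'))
      simp only [D, norm_mul, Real.norm_eq_abs]
      calc _ ≤ Cψ * (K * ((B + C) * |s|) + CA * (C * |s|)) :=
            mul_le_mul (hCψ t ht') ((abs_sub _ _).trans (add_le_add h1 h3)) (abs_nonneg _) hCψ0
        _ = _ := by ring
    · refine ae_of_all _ fun t ht => ?_
      rw [uIoc_of_le hab.le] at ht
      have ht' := Ioc_subset_Icc_self ht
      set p := bracket n a b x z t with hpdef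
      set L' := fderivWithin ℝ L (jetDomain m n a b) p with hL'
      have hO : (fun s => jetShift n G s (u s t) t) =O[𝓝[≠] (0 : ℝ)] (fun s : ℝ => s) := by
        refine Asymptotics.IsBigO.of_bound (B + C) ?_
        filter_upwards [hsmall] with s hs using hsize s hs.1 t ht'
      have htend : Tendsto (fun s => p + jetShift n G s (u s t) t) (𝓝[≠] 0)
          (𝓝[jetDomain m n a b] p) := by
        refine tendsto_nhdsWithin_iff.2 ⟨?_, Eventually.of_forall fun s =>
          add_jetShift_mem (hp ht') _ _ _ _⟩
        have h0 : Tendsto (fun s : ℝ => s) (𝓝[≠] 0) (𝓝 0) := nhdsWithin_le_nhds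
        simpa using tendsto_const_nhds.add (hO.trans_tendsto h0)
      have ho := (hasFDerivWithinAt_lagrangian hL (hp ht')).isLittleO.comp_tendsto htend
      simp only [Function.comp_def, ← hpdef, add_sub_cancel_left] at ho
      replace ho := ho.trans_isBigO hO
      have ho' := (ho.tendsto_div_nhds_zero.add_const (L' (curveJet n G t))).const_mul
        (psiZ n a b L x z t)
      rw [zero_add] at ho'
      refine ho'.congr' ?_
      filter_upwards [hsmall] with s hs
      -- the terms with `∂L/∂z` cancel against the derivative of the integrating factor
      have h1 : L' (jetShift n G s (u s t) t) = s * L' (curveJet n G t) + u s t * partialZ L p := by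
        rw [jetShift_eq, map_add, map_smul, map_smul, partialZ_eq_fderivWithin hL (hp ht'),
          smul_eq_mul, smul_eq_mul]
      have hs' := hs.2
      simp only [D]
      rw [← hpdef, ← hL', h1]
      field_simp
      ring
  refine hlim.congr' ?_
  filter_upwards [hsmall] with s hs
  rw [intervalIntegral.integral_div, hint s hs.1]

/-- The first variation of an extremizer vanishes: the final value `w(b)` along the family of
admissible pairs through `(x + s • G, ·)` has an extremum at `s = 0`. -/
lemma IsExtremizer.integral_fderivWithin_eq_zero (hn : 1 ≤ n) (hab : a < b)
    (hL : ContDiffOn ℝ 1 L (jetDomain m n a b)) {α : Fin n → EuclideanSpace ℝ (Fin m)}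
    (hxz : IsExtremizer n a b γ α L x z) {G : ℝ → EuclideanSpace ℝ (Fin m)}
    (hG : ContDiff ℝ ∞ G) (hGa : ∀ k < n, iteratedDeriv k G a = 0) :
    ∫ t in a..b, psiZ n a b L x z t *
      fderivWithin ℝ L (jetDomain m n a b) (bracket n a b x z t) (curveJet n G t) = 0 := by
  have hx := hxz.admissible.pc_x
  have hz := hxz.admissible.pc_z
  have hbI : b ∈ Icc a b := ⟨hab.le, le_rfl⟩
  obtain ⟨C, hC, s₀, hs₀, h⟩ := exists_shift_solution hab hL hx hz hG
  choose! u hu using h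
  have hlim := tendsto_shift_solution hn hab hL hx hz hG hs₀ hC hu
  obtain ⟨B, hB⟩ := isCompact_Icc.exists_bound_of_continuousOn (hG.continuous.continuousOn
    (s := Icc a b))
  have hB0 : 0 ≤ B := (norm_nonneg _).trans (hB b hbI)
  obtain ⟨ε, hε, hext⟩ := hxz.extremal
  have hsmall : ∀ᶠ s in 𝓝 (0 : ℝ), |s| ≤ s₀ ∧ (B + C) * |s| < ε := by
    have h1 : Tendsto (fun s : ℝ => |s|) (𝓝 0) (𝓝 0) := by
      simpa using (continuous_abs (G := ℝ)).tendsto 0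
    have h2 : Tendsto (fun s : ℝ => (B + C) * |s|) (𝓝 0) (𝓝 0) := by
      simpa using h1.const_mul (B + C)
    exact ((h1.eventually (gt_mem_nhds hs₀)).mono fun _ => le_of_lt).and
      (h2.eventually (gt_mem_nhds hε))
  have hadm : ∀ s, |s| ≤ s₀ → IsAdmissible n a b γ L (x + s • G) (z + u s) := fun s hs =>
    hxz.admissible.shift hab hL hG (hu s hs).1 (hu s hs).2.2
  have hinit : ∀ s : ℝ, HasInitialValues n a b α (x + s • G) := fun s k => by
    have hsG : ContDiff ℝ ∞ (s • G) := contDiff_const.smul hG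
    rw [hx.iteratedDerivWithin_add hab hsG k.2 ⟨le_rfl, hab.le⟩, hxz.init_x k,
      iteratedDeriv_const_smul ((hG.of_le (by exact_mod_cast le_top)).contDiffAt), hGa k k.2,
      smul_zero, add_zero]
  have hclose : ∀ s, |s| ≤ s₀ → (B + C) * |s| < ε →
      (∀ t ∈ Icc a b, ‖(z + u s) t - z t‖ < ε) ∧
        (∀ t ∈ Icc a b, ‖(x + s • G) t - x t‖ < ε) := by
    refine fun s hs hsε => ⟨fun t ht => ?_, fun t ht => ?_⟩
    · rw [Pi.add_apply, add_sub_cancel_left]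
      refine ((hu s hs).2.1 t ht).trans_lt (lt_of_le_of_lt ?_ hsε)
      gcongr; linarith
    · rw [Pi.add_apply, add_sub_cancel_left, Pi.smul_apply, norm_smul, Real.norm_eq_abs]
      refine lt_of_le_of_lt ?_ hsε
      rw [mul_comm]
      gcongr
      linarith [hB t ht]
  have hpos : Tendsto (fun s => u s b / s) (𝓝[>] 0) (𝓝 (∫ t in a..b, psiZ n a b L x z t *
      fderivWithin ℝ L (jetDomain m n a b) (bracket n a b x z t) (curveJet n G t))) :=
    hlim.mono_left (nhdsGT_le_nhdsNE 0)
  have hneg : Tendsto (fun s => u s b / s) (𝓝[<] 0) (𝓝 (∫ t in a..b, psiZ n a b L x z t *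
      fderivWithin ℝ L (jetDomain m n a b) (bracket n a b x z t) (curveJet n G t))) :=
    hlim.mono_left (nhdsLT_le_nhdsNE 0)
  have hsub : ∀ s, (z + u s) b - z b = u s b := fun s => by simp
  rcases hext with hmin | hmax
  · have hsign : ∀ᶠ s in 𝓝 (0 : ℝ), 0 ≤ u s b := by
      filter_upwards [hsmall] with s hs
      have h1 := hclose s hs.1 hs.2
      simpa only [hsub] using hmin _ _ (hadm s hs.1) (hinit s) h1.1 h1.2
    refine le_antisymm (le_of_tendsto hneg ?_) (ge_of_tendsto hpos ?_)
    · filter_upwards [nhdsWithin_le_nhds hsign, self_mem_nhdsWithin] with s h1 h2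
      exact div_nonpos_of_nonneg_of_nonpos h1 (le_of_lt h2)
    · filter_upwards [nhdsWithin_le_nhds hsign, self_mem_nhdsWithin] with s h1 h2
      exact div_nonneg h1 (le_of_lt h2)
  · have hsign : ∀ᶠ s in 𝓝 (0 : ℝ), u s b ≤ 0 := by
      filter_upwards [hsmall] with s hs
      have h1 := hclose s hs.1 hs.2
      simpa only [hsub] using hmax _ _ (hadm s hs.1) (hinit s) h1.1 h1.2
    refine le_antisymm (le_of_tendsto hpos ?_) (ge_of_tendsto hneg ?_)
    · filter_upwards [nhdsWithin_le_nhds hsign, self_mem_nhdsWithin] with s h1 h2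
      exact div_nonpos_of_nonpos_of_nonneg h1 (le_of_lt h2)
    · filter_upwards [nhdsWithin_le_nhds hsign, self_mem_nhdsWithin] with s h1 h2
      exact div_nonneg_of_nonpos h1 (le_of_lt h2)

end FirstVariation

/-! ### The multipliers -/

section Multipliers

variable {F : Type*} [NormedAddCommGroup F] [NormedSpace ℝ F]

/-- The multipliers of the coefficients `f j`, by `ψ₀ = 0` and `ψ_{j+1}(t) = ∫_t^b (ψ_j + f_j)`.
With `ψ₀ = 0` the Euler-Lagrange equation is the case `j = 0` of the formulas for `ψ_j`. -/
noncomputable def multiplier (b : ℝ) (f : ℕ → ℝ → F) : ℕ → ℝ → F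
  | 0 => fun _ => 0
  | j + 1 => fun t => ∫ θ in t..b, (multiplier b f j θ + f j θ)

variable {f : ℕ → ℝ → F}

lemma multiplier_right (j : ℕ) : multiplier b f j b = 0 := by
  cases j with
  | zero => rfl
  | succ j => exact intervalIntegral.integral_same

lemma continuousOn_multiplier (hab : a ≤ b) (hf : ∀ j, IsPiecewiseContinuous a b (f j)) (j : ℕ) :
    ContinuousOn (multiplier b f j) (Icc a b) := by
  induction j with
  | zero => exact continuousOn_const
  | succ j ih =>
    exact ((isPiecewiseContinuous_of_continuousOn ih).add (hf j)).continuousOn_integral_left hab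

lemma isPiecewiseContinuous_multiplier_add (hab : a ≤ b)
    (hf : ∀ j, IsPiecewiseContinuous a b (f j)) (j : ℕ) :
    IsPiecewiseContinuous a b (fun t => multiplier b f j t + f j t) :=
  (isPiecewiseContinuous_of_continuousOn (continuousOn_multiplier hab hf j)).add (hf j)

lemma IsPiecewiseContinuous.intervalIntegrable_smul {g : ℝ → F} (hab : a ≤ b)
    (hg : IsPiecewiseContinuous a b g) {η : ℝ → ℝ} (hη : Continuous η) :
    IntervalIntegrable (fun t => η t • g t) volume a b :=
  ((isPiecewiseContinuous_of_continuousOn hη.continuousOn).smul hg).intervalIntegrable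
    ⟨le_rfl, hab⟩ ⟨hab, le_rfl⟩

/-- The classical formulas on an interval `J`, by descending induction from `ψ_n = -f_n`; `d = n - j`.
That `ψ_{j+1}` is differentiable on `J` with derivative `-ψ_j - f_j` is given, and the derivative of
its sum formula can be taken term by term, which expresses `ψ_j`. -/
lemma sum_eq_of_hasDerivWithinAt {J : Set ℝ} (hJ : UniqueDiffOn ℝ J) {ψ : ℕ → ℝ → F}
    (htop : ∀ t ∈ J, ψ n t = -f n t)
    (hder : ∀ j < n, ∀ t ∈ J, HasDerivWithinAt (ψ (j + 1)) (-ψ j t - f j t) J t)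
    (hdiff : ∀ j ≤ n, IsTimesDifferentiableOn j (f j) J) (d : ℕ) :
    ∀ j, j + d = n → ∀ t ∈ J, ψ j t = ∑ i ∈ Finset.range (d + 1),
      (-1 : ℝ) ^ (i + 1) • iteratedDerivWithin i (f (i + j)) J t := by
  induction d with
  | zero =>
    rintro j rfl t ht
    simpa using htop t ht
  | succ d ih =>
    intro j hj t ht
    have h1 := ih (j + 1) (by omega)
    have h2 : HasDerivWithinAt (fun s => ∑ i ∈ Finset.range (d + 1),
        (-1 : ℝ) ^ (i + 1) • iteratedDerivWithin i (f (i + (j + 1))) J s)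
        (∑ i ∈ Finset.range (d + 1),
          (-1 : ℝ) ^ (i + 1) • iteratedDerivWithin (i + 1) (f (i + (j + 1))) J t) J t := by
      refine HasDerivWithinAt.fun_sum fun i hi => HasDerivWithinAt.const_smul _ ?_
      rw [Finset.mem_range] at hi
      rw [iteratedDerivWithin_succ]
      exact (hdiff (i + (j + 1)) (by omega) i (by omega) t ht).hasDerivWithinAt
    have h3 := (hJ t ht).eq_deriv _ (hder j (by omega) t ht) (h2.congr h1 (h1 t ht))
    rw [Finset.sum_range_succ']
    have h4 : ψ j t = -(∑ i ∈ Finset.range (d + 1),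
          (-1 : ℝ) ^ (i + 1) • iteratedDerivWithin (i + 1) (f (i + (j + 1))) J t) - f j t := by
      rw [← h3]; abel
    rw [h4, ← Finset.sum_neg_distrib]
    have hi : ∀ i, i + 1 + j = i + (j + 1) := fun i => by omega
    simp [pow_succ, hi, sub_eq_add_neg]

variable [CompleteSpace F]

lemma hasDerivWithinAt_multiplier (hab : a ≤ b) (hf : ∀ j, IsPiecewiseContinuous a b (f j))
    (j : ℕ) {t : ℝ} (ht : t ∈ Icc a b) (hc : ContinuousWithinAt (f j) (Icc a b) t) :
    HasDerivWithinAt (multiplier b f (j + 1)) (-multiplier b f j t - f j t) (Icc a b) t := by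
  rw [← neg_add']
  exact (isPiecewiseContinuous_multiplier_add hab hf j).hasDerivWithinAt_integral_left ht
    ((continuousOn_multiplier hab hf j t ht).add hc)

lemma isPC_one_multiplier (hab : a < b) (hf : ∀ j, IsPiecewiseContinuous a b (f j)) (j : ℕ) :
    IsPC 1 a b (multiplier b f (j + 1)) := by
  obtain ⟨S, hS⟩ := (hf j).continuous_off_finite
  refine isPC_one_of_hasDerivWithinAt hab (isPiecewiseContinuous_multiplier_add hab.le hf j).neg
    (continuousOn_multiplier hab.le hf (j + 1)) S fun t ht htS => ?_
  rw [neg_add']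
  exact hasDerivWithinAt_multiplier hab.le hf j ht (hS t ht htS)

/-- Integration by parts; the boundary term at `b` vanishes because `ψ_{j+1}(b) = 0`. -/
lemma integral_smul_multiplier_add (hab : a < b) (hf : ∀ j, IsPiecewiseContinuous a b (f j))
    (j : ℕ) {η : ℝ → ℝ} (hη : ContDiff ℝ ∞ η) (hηa : η a = 0) :
    ∫ t in a..b, η t • (multiplier b f j t + f j t) =
      ∫ t in a..b, deriv η t • multiplier b f (j + 1) t := by
  obtain ⟨S, hS⟩ := (hf j).continuous_off_finite
  have hη' : Continuous (deriv η) := (contDiff_infty_iff_deriv.1 hη).2.continuous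
  have h1 := isPiecewiseContinuous_multiplier_add hab.le hf j
  have h2 := continuousOn_multiplier hab.le hf (j + 1)
  have h3 := ((isPiecewiseContinuous_of_continuousOn hη'.continuousOn).smul
    (isPiecewiseContinuous_of_continuousOn h2)).sub
    ((isPiecewiseContinuous_of_continuousOn hη.continuous.continuousOn).smul h1)
  have h4 := h3.integral_eq_sub (v := fun t => η t • multiplier b f (j + 1) t)
    (hη.continuous.continuousOn.smul h2) (S := S) (fun t ht htS => by
      have hd := ((contDiff_infty_iff_deriv.1 hη).1 t).hasDerivAt.hasDerivWithinAt (s := Icc a b)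
      refine (hd.smul (hasDerivWithinAt_multiplier hab.le hf j ht (hS t ht htS))).congr_deriv ?_
      rw [← neg_add', smul_neg]; abel) ⟨le_rfl, hab.le⟩ ⟨hab.le, le_rfl⟩
  rw [intervalIntegral.integral_sub
    ((isPiecewiseContinuous_of_continuousOn h2).intervalIntegrable_smul hab.le hη')
    (h1.intervalIntegrable_smul hab.le hη.continuous), multiplier_right, hηa, zero_smul, smul_zero,
    sub_zero, sub_eq_zero] at h4
  exact h4.symm

/-- Repeated integration by parts moves all derivatives of order below `k` onto `h^(k)`. No condition
at `b` is needed, since the multipliers vanish there. -/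
lemma sum_integral_iteratedDeriv_smul (hab : a < b) (hf : ∀ j, IsPiecewiseContinuous a b (f j))
    {h : ℝ → ℝ} (hh : ContDiff ℝ ∞ h) (k : ℕ) (h0 : ∀ i < k, iteratedDeriv i h a = 0) :
    ∑ j ∈ Finset.range k, ∫ t in a..b, iteratedDeriv j h t • f j t =
      ∫ t in a..b, iteratedDeriv k h t • multiplier b f k t := by
  induction k with
  | zero => simp [multiplier]
  | succ k ih =>
    have hk : ContDiff ℝ ∞ (iteratedDeriv k h) := by
      rw [iteratedDeriv_eq_iterate]; exact hh.iterate_deriv k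
    rw [Finset.sum_range_succ, ih fun i hi => h0 i (by omega), iteratedDeriv_succ,
      ← integral_smul_multiplier_add hab hf k hk (h0 k (Nat.lt_succ_self k)),
      ← intervalIntegral.integral_add
        ((isPiecewiseContinuous_of_continuousOn
          (continuousOn_multiplier hab.le hf k)).intervalIntegrable_smul hab.le hk.continuous)
        ((hf k).intervalIntegrable_smul hab.le hk.continuous)]
    simp only [smul_add]

/-- The `k`-fold primitive of `g` from `a`. -/
lemma exists_iteratedDeriv_eq (a : ℝ) (k : ℕ) {g : ℝ → ℝ} (hg : ContDiff ℝ ∞ g) :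
    ∃ h : ℝ → ℝ, ContDiff ℝ ∞ h ∧ iteratedDeriv k h = g ∧ ∀ i < k, iteratedDeriv i h a = 0 := by
  induction k with
  | zero => exact ⟨g, hg, by simp, by simp⟩
  | succ k ih =>
    obtain ⟨h, hh, hhk, hh0⟩ := ih
    have hd : ∀ t, HasDerivAt (fun t => ∫ θ in a..t, h θ) (h t) t := fun t =>
      intervalIntegral.integral_hasDerivAt_right (hh.continuous.intervalIntegrable _ _)
        hh.continuous.stronglyMeasurable.stronglyMeasurableAtFilter hh.continuous.continuousAt
    have hderiv : deriv (fun t => ∫ θ in a..t, h θ) = h := funext fun t => (hd t).deriv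
    refine ⟨fun t => ∫ θ in a..t, h θ, contDiff_infty_iff_deriv.2
      ⟨fun t => (hd t).differentiableAt, hderiv.symm ▸ hh⟩, ?_, fun i hi => ?_⟩
    · rw [iteratedDeriv_succ', hderiv, hhk]
    · cases i with
      | zero => simp
      | succ i => rw [iteratedDeriv_succ', hderiv]; exact hh0 i (by omega)

/-- The vanishing first variation, transported to the top multiplier: every smooth function is
an `n`-th derivative `h^(n)` with vanishing initial values. -/
lemma integral_smul_multiplier_add_eq_zero (hab : a < b)
    (hf : ∀ j, IsPiecewiseContinuous a b (f j))
    (hvar : ∀ h : ℝ → ℝ, ContDiff ℝ ∞ h → (∀ i < n, iteratedDeriv i h a = 0) →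
      ∑ j ∈ Finset.range (n + 1), ∫ t in a..b, iteratedDeriv j h t • f j t = 0)
    {g : ℝ → ℝ} (hg : ContDiff ℝ ∞ g) :
    ∫ t in a..b, g t • (multiplier b f n t + f n t) = 0 := by
  obtain ⟨h, hh, rfl, h0⟩ := exists_iteratedDeriv_eq a n hg
  have := hvar h hh h0
  rw [Finset.sum_range_succ, sum_integral_iteratedDeriv_smul hab hf hh n h0,
    ← intervalIntegral.integral_add
      ((isPiecewiseContinuous_of_continuousOn
        (continuousOn_multiplier hab.le hf n)).intervalIntegrable_smul hab.le hg.continuous)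
      ((hf n).intervalIntegrable_smul hab.le hg.continuous)] at this
  simpa only [smul_add] using this

/-- The fundamental lemma of the calculus of variations, at a point of continuity. -/
lemma IsPiecewiseContinuous.eq_zero_of_integral_smul_eq_zero (hab : a < b) {u : ℝ → F}
    (hu : IsPiecewiseContinuous a b u)
    (h : ∀ g : ℝ → ℝ, ContDiff ℝ ∞ g → ∫ t in a..b, g t • u t = 0) {t : ℝ} (ht : t ∈ Icc a b)
    (hc : ContinuousWithinAt u (Icc a b) t) : u t = 0 := by
  have hae : ∀ᵐ s, s ∈ Ioo a b → u s = 0 := by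
    refine isOpen_Ioo.ae_eq_zero_of_integral_contDiff_smul_eq_zero
      (hu.integrableOn.mono_set Ioo_subset_Icc_self).locallyIntegrableOn fun g hg _ hsupp => ?_
    rw [← h g hg, intervalIntegral.integral_of_le hab.le]
    refine (setIntegral_eq_integral_of_forall_compl_eq_zero fun s hs => ?_).symm
    rw [image_eq_zero_of_notMem_tsupport fun h => hs (Ioo_subset_Ioc_self (hsupp h)), zero_smul]
  -- the primitive of `u` vanishes, and so does its derivative
  have hprim : ∀ s ∈ Icc a b, ∫ θ in s..b, u θ = 0 := fun s hs => by
    refine intervalIntegral.integral_zero_ae ?_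
    filter_upwards [hae, compl_mem_ae_iff.2 (measure_singleton b)] with θ hθ hθb hmem
    rw [uIoc_of_le hs.2] at hmem
    exact hθ ⟨hs.1.trans_lt hmem.1, lt_of_le_of_ne hmem.2 hθb⟩
  have h1 := hu.hasDerivWithinAt_integral_left ht hc
  have h2 := (hasDerivWithinAt_const t (Icc a b) (0 : F)).congr hprim (hprim t ht)
  exact neg_eq_zero.1 ((uniqueDiffOn_Icc hab t ht).eq_deriv _ h1 h2)

lemma IsTestFunction.deriv {η : ℝ → ℝ} (hη : IsTestFunction a b η) :
    IsTestFunction a b (_root_.deriv η) :=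
  ⟨(contDiff_infty_iff_deriv.1 hη.smooth).2, hη.compact.deriv,
    (closure_minimal support_deriv_subset (isClosed_tsupport η)).trans hη.support⟩

lemma IsTestFunction.left {η : ℝ → ℝ} (hη : IsTestFunction a b η) : η a = 0 :=
  image_eq_zero_of_notMem_tsupport fun h => lt_irrefl a (hη.support h).1

/-- The formulas for the multipliers against test functions, by repeated integration by parts from
the top multiplier downwards; `d = n - j`. -/
lemma integral_smul_multiplier (hab : a < b) (hf : ∀ j, IsPiecewiseContinuous a b (f j))
    (htop : ∀ g : ℝ → ℝ, ContDiff ℝ ∞ g →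
      ∫ t in a..b, g t • (multiplier b f n t + f n t) = 0) (d : ℕ) :
    ∀ j, j + d = n → ∀ η : ℝ → ℝ, IsTestFunction a b η →
      ∫ t in a..b, η t • multiplier b f j t =
        -∑ i ∈ Finset.range (d + 1), ∫ t in a..b, iteratedDeriv i η t • f (i + j) t := by
  have hsplit : ∀ j, ∀ η : ℝ → ℝ, IsTestFunction a b η →
      ∫ t in a..b, η t • (multiplier b f j t + f j t) =
        (∫ t in a..b, η t • multiplier b f j t) + ∫ t in a..b, η t • f j t := by
    intro j η hη
    simp only [smul_add]
    exact intervalIntegral.integral_add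
      ((isPiecewiseContinuous_of_continuousOn
        (continuousOn_multiplier hab.le hf j)).intervalIntegrable_smul hab.le hη.smooth.continuous)
      ((hf j).intervalIntegrable_smul hab.le hη.smooth.continuous)
  induction d with
  | zero =>
    rintro j rfl η hη
    have := htop η hη.smooth
    rw [add_zero, hsplit j η hη] at this
    simpa using eq_neg_of_add_eq_zero_left this
  | succ d ih =>
    intro j hj η hη
    have h1 := integral_smul_multiplier_add hab hf j hη.smooth hη.left
    rw [hsplit j η hη, ih (j + 1) (by omega) _ hη.deriv] at h1
    rw [eq_sub_of_add_eq h1, Finset.sum_range_succ' _ (d + 1)]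
    have hi : ∀ i, i + 1 + j = i + (j + 1) := fun i => by omega
    simp only [← iteratedDeriv_succ', iteratedDeriv_zero, zero_add, hi]
    rw [neg_add, sub_eq_add_neg]

end Multipliers

/-! ### Necessary conditions for extremizers -/

lemma uniqueDiffOn_of_ordConnected {J : Set ℝ} (hJ : J.OrdConnected) (hne : J.Nontrivial) :
    UniqueDiffOn ℝ J := by
  obtain ⟨s, hs, t, ht, hst⟩ := hne.exists_lt
  exact uniqueDiffOn_convex hJ.convex ((nonempty_Ioo.2 hst).mono
    (isOpen_Ioo.subset_interior_iff.2 (Ioo_subset_Icc_self.trans (hJ.out hs ht))))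

/-- The vanishing first variation, in terms of the momenta. -/
lemma IsExtremizer.sum_integral_momentum_eq_zero (hn : 1 ≤ n) (hab : a < b) {γ : ℝ}
    {α : Fin n → EuclideanSpace ℝ (Fin m)} {L : Jet m n → ℝ}
    (hL : ContDiffOn ℝ 1 L (jetDomain m n a b)) {x : ℝ → EuclideanSpace ℝ (Fin m)} {z : ℝ → ℝ}
    (hxz : IsExtremizer n a b γ α L x z) {h : ℝ → ℝ} (hh : ContDiff ℝ ∞ h)
    (h0 : ∀ i < n, iteratedDeriv i h a = 0) :
    ∑ j ∈ Finset.range (n + 1),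
      ∫ t in a..b, iteratedDeriv j h t • momentum n a b L x z j t = 0 := by
  have hx := hxz.admissible.pc_x
  have hz := hxz.admissible.pc_z
  have hint : ∀ j, IntervalIntegrable
      (fun t => iteratedDeriv j h t • momentum n a b L x z j t) volume a b := fun j =>
    (isPiecewiseContinuous_momentum hab hL hx hz j).intervalIntegrable_smul hab.le
      (continuous_iteratedDeriv_of_contDiff hh j)
  rw [← intervalIntegral.integral_finsetSum fun j _ => hint j]
  refine ext_inner_left ℝ fun v => ?_
  have hk : ∀ k t, iteratedDeriv k (fun t => h t • v) t = iteratedDeriv k h t • v := fun k t =>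
    iteratedDeriv_smul_const ((hh.of_le (by exact_mod_cast le_top)).contDiffAt) v
  have hvar := hxz.integral_fderivWithin_eq_zero hn hab hL (G := fun t => h t • v)
    (hh.smul contDiff_const) fun k hkn => by rw [hk, h0 k hkn, zero_smul]
  rw [inner_zero_right, ← hvar]
  have hcomm := (innerSL ℝ v).intervalIntegral_comp_comm
    (IntervalIntegrable.sum (Finset.range (n + 1)) fun j _ => hint j)
  simp only [Finset.sum_apply, innerSL_apply_apply] at hcomm
  rw [← hcomm]
  refine intervalIntegral.integral_congr fun t ht => ?_
  rw [uIcc_of_le hab.le] at ht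
  have hp := bracket_mem_jetDomain (n := n) (x := x) (z := z) ht
  have hcurve : curveJet n (fun t => h t • v) t =
      ∑ j : Fin (n + 1), ((0, Pi.single j (iteratedDeriv j h t • v), 0) : Jet m n) := by
    refine Prod.ext ?_ (Prod.ext ?_ ?_)
    · simp [curveJet, Prod.fst_sum]
    · simp only [curveJet, hk, Prod.snd_sum, Prod.fst_sum]
      exact (Finset.univ_sum_single _).symm
    · simp [curveJet, Prod.snd_sum]
  rw [hcurve, map_sum, Finset.mul_sum, inner_sum, Finset.sum_range]
  refine Finset.sum_congr rfl fun j _ => ?_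
  rw [← inner_partialX hL hp j, momentum, inner_smul_right, inner_smul_right, inner_smul_right,
    real_inner_comm]
  ring

end Herglotz

theorem mainTheorem1 {m n : ℕ} (hn : 1 ≤ n) {a b : ℝ} (hab : a < b) (γ : ℝ)
    (α : Fin n → EuclideanSpace ℝ (Fin m)) (L : Herglotz.Jet m n → ℝ)
    (hL : ContDiffOn ℝ 1 L (Icc a b ×ˢ (univ : Set ((Fin (n + 1) → EuclideanSpace ℝ (Fin m)) × ℝ))))
    (x : ℝ → EuclideanSpace ℝ (Fin m)) (z : ℝ → ℝ)
    (hxz : Herglotz.IsExtremizer n a b γ α L x z) :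
    -- the Euler-Lagrange equation, with derivatives in the sense of distributions
    (∀ η : ℝ → ℝ, Herglotz.IsTestFunction a b η →
      ∑ j ∈ Finset.range (n + 1),
        (-1 : ℝ) ^ j • Herglotz.distDeriv a b j (Herglotz.momentum n a b L x z j) η = 0) ∧
    ∃ ψ : ℕ → ℝ → EuclideanSpace ℝ (Fin m),
      -- the multipliers are continuous and piecewise continuously differentiable, are given by the
      -- alternating sums, and satisfy the transversality conditions
      (∀ j : ℕ, 1 ≤ j → j ≤ n →
        Herglotz.IsPC 1 a b (ψ j) ∧
        (∀ η : ℝ → ℝ, Herglotz.IsTestFunction a b η →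
          ∫ t in a..b, η t • ψ j t =
            ∑ i ∈ Finset.range (n - j + 1),
              (-1 : ℝ) ^ (i + 1) •
                Herglotz.distDeriv a b i (Herglotz.momentum n a b L x z (i + j)) η) ∧
        ψ j b = 0) ∧
      -- the same relations pointwise, with the derivatives taken of the grouped sums
      (∀ t ∈ Herglotz.regularPoints n a b x,
        ψ n t = -Herglotz.momentum n a b L x z n t ∧
        (∀ j : ℕ, 1 ≤ j → j < n →
          HasDerivWithinAt (ψ (j + 1)) (-ψ j t - Herglotz.momentum n a b L x z j t)
            (Icc a b) t) ∧
        HasDerivWithinAt (ψ 1) (-Herglotz.momentum n a b L x z 0 t) (Icc a b) t) ∧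
      -- the classical formulas, wherever the individual derivatives exist
      (∀ J : Set ℝ, J.OrdConnected → J.Nontrivial → J ⊆ Herglotz.regularPoints n a b x →
        (∀ j : ℕ, j ≤ n →
          Herglotz.IsTimesDifferentiableOn j (Herglotz.momentum n a b L x z j) J) →
        ∀ t ∈ J,
          ∑ j ∈ Finset.range (n + 1),
            (-1 : ℝ) ^ j • iteratedDerivWithin j (Herglotz.momentum n a b L x z j) J t = 0 ∧
          ∀ j : ℕ, 1 ≤ j → j ≤ n →
            ψ j t = ∑ i ∈ Finset.range (n - j + 1),
              (-1 : ℝ) ^ (i + 1) •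
                iteratedDerivWithin i (Herglotz.momentum n a b L x z (i + j)) J t) := by
  have hx := hxz.admissible.pc_x
  have hz := hxz.admissible.pc_z
  set f := Herglotz.momentum n a b L x z with hfdef
  have hf : ∀ j, Herglotz.IsPiecewiseContinuous a b (f j) :=
    Herglotz.isPiecewiseContinuous_momentum hab hL hx hz
  have htop : ∀ g : ℝ → ℝ, ContDiff ℝ ∞ g →
      ∫ t in a..b, g t • (Herglotz.multiplier b f n t + f n t) = 0 := fun g hg =>
    Herglotz.integral_smul_multiplier_add_eq_zero hab hf
      (fun h hh h0 => hxz.sum_integral_momentum_eq_zero hn hab hL hh h0) hg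
  have hreg : ∀ t ∈ Herglotz.regularPoints n a b x, ∀ j, ContinuousWithinAt (f j) (Icc a b) t :=
    fun t ht j => Herglotz.continuousWithinAt_momentum hn hab hL hx hz j ht
  have htop' : ∀ t ∈ Herglotz.regularPoints n a b x, Herglotz.multiplier b f n t = -f n t :=
    fun t ht => eq_neg_of_add_eq_zero_left
      ((Herglotz.isPiecewiseContinuous_multiplier_add hab.le hf n).eq_zero_of_integral_smul_eq_zero
        hab htop ht.1
        ((Herglotz.continuousOn_multiplier hab.le hf n t ht.1).add (hreg t ht n)))
  have hder : ∀ j, ∀ t ∈ Herglotz.regularPoints n a b x,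
      HasDerivWithinAt (Herglotz.multiplier b f (j + 1))
        (-Herglotz.multiplier b f j t - f j t) (Icc a b) t := fun j t ht =>
    Herglotz.hasDerivWithinAt_multiplier hab.le hf j ht.1 (hreg t ht j)
  have hsign : ∀ (i : ℕ) (v : EuclideanSpace ℝ (Fin m)),
      (-1 : ℝ) ^ i • (-1 : ℝ) ^ i • v = v := fun i v => by
    rw [smul_smul, ← mul_pow]; simp
  refine ⟨fun η hη => ?_, Herglotz.multiplier b f, fun j hj1 hjn => ⟨?_, fun η hη => ?_,
    Herglotz.multiplier_right j⟩, fun t ht => ⟨htop' t ht, fun j _ _ => hder j t ht, ?_⟩,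
    fun J hJ hJne hJR hdiff t ht => ?_⟩
  · have h := Herglotz.integral_smul_multiplier hab hf htop n 0 (zero_add n) η hη
    simp only [Herglotz.multiplier, smul_zero, intervalIntegral.integral_zero, add_zero] at h
    simp only [Herglotz.distDeriv, hsign]
    exact neg_eq_zero.1 h.symm
  · obtain ⟨k, rfl⟩ : ∃ k, j = k + 1 := ⟨j - 1, by omega⟩
    exact Herglotz.isPC_one_multiplier hab hf k
  · rw [Herglotz.integral_smul_multiplier hab hf htop (n - j) j (by omega) η hη,
      ← Finset.sum_neg_distrib]
    refine Finset.sum_congr rfl fun i _ => ?_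
    rw [Herglotz.distDeriv, pow_succ, mul_neg_one, neg_smul, hsign]
  · simpa [Herglotz.multiplier] using hder 0 t ht
  · have hsum := Herglotz.sum_eq_of_hasDerivWithinAt
      (Herglotz.uniqueDiffOn_of_ordConnected hJ hJne) (fun s hs => htop' s (hJR hs))
      (fun j _ s hs => (hder j s (hJR hs)).mono fun r hr => (hJR hr).1) hdiff
    refine ⟨?_, fun j _ hjn => hsum (n - j) j (by omega) t ht⟩
    have h := hsum n 0 (zero_add n) t ht
    simp only [Herglotz.multiplier, pow_succ, mul_neg_one, neg_smul, Finset.sum_neg_distrib,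
      add_zero] at h
    exact neg_eq_zero.1 h.symm
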